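/- Consider the problem of rounding a fractional matching that is revealed online in two stages. An instance consists of finite sets $I$ (offline nodes) and $B_1, B_2$ (two disjoint batches of online nodes), edge sets $E_1 \subseteq B_1 \times I$ and $E_2 \subseteq B_2 \times I$, and vectors $x \in [0,1]^{B_1 \times I}$ and $y \in [0,1]^{B_2 \times I}$ that vanish outside $E_1$ and $E_2$ respectively and jointly form a fractional matching of the full bipartite graph: $\sum_{i \in I} x_{ia} \le 1$ for all $a \in B_1$, $\sum_{i \in I} y_{ib} \le 1$ for all $b \in B_2$, and $\sum_{a \in B_1} x_{ia} + \sum_{b \in B_2} y_{ib} \le 1$ for all $i \in I$. A (randomized) online rounding scheme first selects a random matching $M_1 \subseteq E_1$ knowing only $(I, B_1, E_1, x)$; then $(B_2, E_2, y)$ is revealed, and the scheme selects a random matching $M_2 \subseteq E_2$ that uses only offline nodes left unmatched by $M_1$. The instance is fixed in advance by an adversary, i.e. it does not depend on the random choices of the scheme. A scheme is vertex-uniform with factor $c$ if on every instance, for every $i \in I$, $$\Pr[i \text{ is matched by } M_1 \cup M_2] \ \ge\ c \cdot \Big(\sum_{a \in B_1} x_{ia} + \sum_{b \in B_2} y_{ib}\Big),$$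 and edge-uniform with factor $c$ if on every instance $\Pr[e \in M_1] \ge c \cdot x_e$ for every $e \in E_1$ and $\Pr[e \in M_2] \ge c \cdot y_e$ for every $e \in E_2$. Then the largest $c$ for which there is a vertex-uniform scheme with factor $c$ is exactly $c_{\mathsf V} = 7/8$, and the largest $c$ for which there is an edge-uniform scheme with factor $c$ is exactly $c_{\mathsf E} = 2\sqrt2 - 2$; in particular, both maxima are attained. -/

import Mathlib

namespace TwoStageMatching

/-- One batch of a bipartite graph together with a fractional matching on it: `B` is the set of
online nodes of the batch, `I` the set of offline nodes, `edges` the edges between them, and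
`mass (b, i)` the fractional value of the pair `(b, i)`, which vanishes off the edges. -/
structure FractionalBatch (B I : Type) [Fintype B] [Fintype I] where
  edges : Finset (B × I)
  mass : B × I → ℝ
  mass_nonneg : ∀ e, 0 ≤ mass e
  mass_eq_zero : ∀ e, e ∉ edges → mass e = 0
  online_le_one : ∀ b, ∑ i, mass (b, i) ≤ 1
  offline_le_one : ∀ i, ∑ b, mass (b, i) ≤ 1

/-- The fractional degree of the offline node `i` in a batch. -/
def FractionalBatch.degree {B I : Type} [Fintype B] [Fintype I]
    (x : FractionalBatch B I) (i : I) : ℝ :=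
  ∑ b, x.mass (b, i)

/-- The two batches together form a fractional matching of the full graph. The constraints at the
online nodes hold in each batch already, so only those at the offline nodes remain. -/
def JointlyFeasible {B₁ B₂ I : Type} [Fintype B₁] [Fintype B₂] [Fintype I]
    (x : FractionalBatch B₁ I) (y : FractionalBatch B₂ I) : Prop :=
  ∀ i, x.degree i + y.degree i ≤ 1

/-- No two distinct edges of `M` share an online or an offline node. -/
def IsMatching {B I : Type} (M : Finset (B × I)) : Prop :=
  ∀ e ∈ M, ∀ f ∈ M, e.1 = f.1 ∨ e.2 = f.2 → e = f

/-- The edge set `M` contains an edge at the offline node `i`. -/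
def Covers {B I : Type} (M : Finset (B × I)) (i : I) : Prop :=
  ∃ b, (b, i) ∈ M

/-- The integral matchings that may be selected in the first stage. -/
abbrev FirstMatching {B₁ I : Type} [Fintype B₁] [Fintype I] (x : FractionalBatch B₁ I) : Type :=
  {M : Finset (B₁ × I) // M ⊆ x.edges ∧ IsMatching M}

/-- The integral matchings that may be selected in the second stage after `M₁` was selected in the
first: they use only offline nodes that `M₁` left unmatched. -/
abbrev SecondMatching {B₁ B₂ I : Type} [Fintype B₁] [Fintype B₂] [Fintype I]
    {x : FractionalBatch B₁ I} (M₁ : FirstMatching x) (y : FractionalBatch B₂ I) : Type :=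
  {M : Finset (B₂ × I) // M ⊆ y.edges ∧ IsMatching M ∧ ∀ i, Covers M i → ¬ Covers M₁.1 i}

/-- A randomized online rounding scheme. Its first-stage matching is sampled knowing only the first
batch; its second-stage matching is then sampled knowing both batches and the matching already
selected. -/
structure OnlineRoundingScheme where
  first : ∀ {I B₁ : Type} [Fintype I] [Fintype B₁] (x : FractionalBatch B₁ I),
    PMF (FirstMatching x)
  second : ∀ {I B₁ B₂ : Type} [Fintype I] [Fintype B₁] [Fintype B₂]
    (x : FractionalBatch B₁ I) (y : FractionalBatch B₂ I) (M₁ : FirstMatching x),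
    PMF (SecondMatching M₁ y)

namespace OnlineRoundingScheme

/-- The joint law of the pair (first-stage matching, second-stage matching). -/
noncomputable def outcome (S : OnlineRoundingScheme) {I B₁ B₂ : Type} [Fintype I] [Fintype B₁]
    [Fintype B₂] (x : FractionalBatch B₁ I) (y : FractionalBatch B₂ I) :
    PMF (Finset (B₁ × I) × Finset (B₂ × I)) :=
  (S.first x).bind fun M₁ => (S.second x y M₁).map fun M₂ => (M₁.1, M₂.1)

/-- The probability that the selected pair of matchings satisfies `P`. -/
noncomputable def prob (S : OnlineRoundingScheme) {I B₁ B₂ : Type} [Fintype I] [Fintype B₁]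
    [Fintype B₂] (x : FractionalBatch B₁ I) (y : FractionalBatch B₂ I)
    (P : Finset (B₁ × I) → Finset (B₂ × I) → Prop) : ℝ :=
  ((S.outcome x y).toOuterMeasure {ω | P ω.1 ω.2}).toReal

/-- On every instance, each offline node is matched with probability at least `c` times its
fractional degree in the full graph. -/
def IsVertexUniform (S : OnlineRoundingScheme) (c : ℝ) : Prop :=
  ∀ {I B₁ B₂ : Type} [Fintype I] [Fintype B₁] [Fintype B₂]
    (x : FractionalBatch B₁ I) (y : FractionalBatch B₂ I), JointlyFeasible x y →
    ∀ i, c * (x.degree i + y.degree i) ≤ S.prob x y fun M₁ M₂ => Covers M₁ i ∨ Covers M₂ i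

/-- On every instance, each edge is matched with probability at least `c` times its fractional
value. -/
def IsEdgeUniform (S : OnlineRoundingScheme) (c : ℝ) : Prop :=
  ∀ {I B₁ B₂ : Type} [Fintype I] [Fintype B₁] [Fintype B₂]
    (x : FractionalBatch B₁ I) (y : FractionalBatch B₂ I), JointlyFeasible x y →
    (∀ e ∈ x.edges, c * x.mass e ≤ S.prob x y fun M₁ _ => e ∈ M₁) ∧
    (∀ e ∈ y.edges, c * y.mass e ≤ S.prob x y fun _ M₂ => e ∈ M₂)

end OnlineRoundingScheme

end TwoStageMatching

/-!
Both factors are attained by the same kind of first stage, dependent rounding of the fractional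
matching of the first batch, scaled by `c` in the edge-uniform case. A step moves the fractional
matching along a cycle of fractional edges, or a path of them between two leaves, forwards or
backwards with mean zero, until another constraint becomes tight. The vector of offline degrees then
moves along an exchange direction: one coordinate changes, or mass is shifted between two
coordinates. Hence the expectation of a function that is convex along exchange directions does not
decrease, and the rounding ends at an integral matching (`exists_isDependentRounding`). The
multilinear extension of a submodular function, as a function of the degrees, has this convexity,
and the value of a maximum weight matching is submodular in the set of offline nodes
(`matchValue_submodular`). So the value of a maximum weight matching of the second batch into the
offline nodes left free is in expectation at least what it would be if each offline node were
occupied independently.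

It remains to bound this independent value from below.

* Vertex weights `a`: let `x` and `d` be the vectors of first-batch and second-batch degrees. If the
  second batch is rounded dependently as well, and the nodes that its rounding covers are free for
  sure, then the rounded matching is available. The price of this correlation is bounded by a
  quadratic energy that outweighs the curvature of the multilinear extension
  (`exchangeConvex_energy_sub_multilinear`). At most `x i * d i / 2` is lost at the node `i`, and
  `x i * d i / 2 ≤ (x i + d i) / 8` as `x i + d i ≤ 1` (`vertex_le_multilinear_matchValue`).
* Edge weights: circulations reduce the support of the second batch to a forest. In a forest some
  online node has only leaves as neighbours, except possibly for one, so it can be peeled off. Its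
  contribution is controlled by an inequality for one star (`star_inequality`), which is tight for
  two neighbours of value `1 / 2` and determines `c` (`edge_le_multilinear_matchValue`).

These bounds hold for every choice of weights, and minimax duality (`exists_mixed_strategy`) turns
them into one randomized second stage that meets all targets at once.

For the upper bounds the first batch is complete between `n` online and `2 * n` offline nodes, with
equal values, so that each offline node has degree `1 / 2`; the second batch is one online node that
puts `1 / 2` on each node of a pair. The first stage does not know the pair, so the requirements for
all pairs hold at once. They make it unlikely that both nodes of a pair are free (in the
vertex-uniform case) or that both are occupied (in the edge-uniform case), whereas the number of
free nodes is at least `n` and the expected number of occupied ones at least `c * n`. Comparing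
second moments and letting `n` tend to infinity gives `7 / 8` and the root of `c ^ 2 + 4 * c = 4`.
-/

namespace TwoStageMatching

/-! ### Circulations -/

section Circulation

variable {α V : Type} [Fintype α] [DecidableEq V]

/-- The net flow out of the vertex `u` of the real-valued flow `v` on a directed multigraph with
edge set `α`, in which `e` runs from `src e` to `tgt e`. -/
def netFlow (src tgt : α → V) (v : α → ℝ) (u : V) : ℝ :=
  ∑ e, v e * ((if src e = u then 1 else 0) - (if tgt e = u then 1 else 0))

theorem netFlow_add (src tgt : α → V) (v w : α → ℝ) :
    netFlow src tgt (v + w) = netFlow src tgt v + netFlow src tgt w := by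
  funext u
  simp [netFlow, add_mul, Finset.sum_add_distrib]

theorem netFlow_single [DecidableEq α] (src tgt : α → V) (e : α) (r : ℝ) :
    netFlow src tgt (Pi.single e r) = Pi.single (src e) r - Pi.single (tgt e) r := by
  funext u
  rw [netFlow, Finset.sum_eq_single e]
  · simp only [Pi.single_eq_same, Pi.sub_apply, Pi.single_apply]
    simp only [eq_comm (a := u)]
    split_ifs <;> simp
  · intro f _ hf
    simp [hf]
  · simp

/-- Walking away from `u` along edges of `D` ends in a leaf `w` or closes a cycle. The walk is
carried by the unit flow that it supports. -/
theorem exists_circulation_or_flow_to_leaf [DecidableEq α] (src tgt : α → V)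
    (hne : ∀ e, src e ≠ tgt e) (D : Finset α) :
    ∀ u, (∃ e ∈ D, src e = u ∨ tgt e = u) →
      (∃ v : α → ℝ, v ≠ 0 ∧ (∀ e, e ∉ D → v e = 0) ∧ netFlow src tgt v = 0) ∨
      ∃ w, w ≠ u ∧ (∃! e, e ∈ D ∧ (src e = w ∨ tgt e = w)) ∧
        ∃ v : α → ℝ, (∀ e, e ∉ D → v e = 0) ∧
          netFlow src tgt v = Pi.single u 1 - Pi.single w 1 := by
  induction D using Finset.strongInduction with
  | H D ih =>
    rintro u ⟨e, heD, heu⟩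
    obtain ⟨u', hu', r, hr, hends, hflow⟩ : ∃ u', u' ≠ u ∧ ∃ r : ℝ, r ≠ 0 ∧
        (∀ a, (src e = a ∨ tgt e = a) ↔ (a = u ∨ a = u')) ∧
        netFlow src tgt (Pi.single e r) = Pi.single u 1 - Pi.single u' 1 := by
      rcases heu with rfl | rfl
      · refine ⟨tgt e, (hne e).symm, 1, one_ne_zero, fun a => ?_, netFlow_single _ _ _ _⟩
        simp only [eq_comm]
      · refine ⟨src e, hne e, -1, by norm_num, fun a => ?_, ?_⟩
        · simp only [eq_comm (b := a), or_comm]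
        · rw [netFlow_single, Pi.single_neg, Pi.single_neg]
          abel
    have hsub : D.erase e ⊂ D := Finset.erase_ssubset heD
    by_cases hiso : ∃ f ∈ D.erase e, src f = u' ∨ tgt f = u'
    · rcases ih _ hsub u' hiso with ⟨v, hv0, hvD, hv⟩ | ⟨w, hwu', ⟨f, ⟨hfD, hfw⟩, hfu⟩, v, hvD, hv⟩
      · exact Or.inl ⟨v, hv0, fun f hf => hvD f fun h => hf (Finset.mem_of_mem_erase h), hv⟩
      · have hsupp : ∀ f, f ∉ D → (v + (Pi.single e r : α → ℝ)) f = 0 := by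
          intro f hf
          have hfe : f ≠ e := fun h => hf (h ▸ heD)
          simp [hfe, hvD f fun h => hf (Finset.mem_of_mem_erase h)]
        have hnet : netFlow src tgt (v + Pi.single e r) = Pi.single u 1 - Pi.single w 1 := by
          rw [netFlow_add, hv, hflow]
          abel
        by_cases hwu : w = u
        · left
          refine ⟨v + Pi.single e r, fun h => hr ?_, hsupp, by rw [hnet, hwu, sub_self]⟩
          have := congrFun h e
          simpa [hvD e (by simp)] using this
        · right
          refine ⟨w, hwu, ⟨f, ⟨Finset.mem_of_mem_erase hfD, hfw⟩, ?_⟩, _, hsupp, hnet⟩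
          rintro f' ⟨hf'D, hf'w⟩
          refine hfu f' ⟨Finset.mem_erase.2 ⟨?_, hf'D⟩, hf'w⟩
          rintro rfl
          rcases (hends w).1 hf'w with h | h
          · exact hwu h
          · exact hwu' h
    · right
      refine ⟨u', hu', ⟨e, ⟨heD, (hends u').2 (Or.inr rfl)⟩, ?_⟩, Pi.single e r, ?_, hflow⟩
      · rintro f ⟨hfD, hfu⟩
        by_contra hfe
        exact hiso ⟨f, Finset.mem_erase.2 ⟨hfe, hfD⟩, hfu⟩
      · intro f hf
        have hfe : f ≠ e := fun h => hf (h ▸ heD)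
        simp [hfe]

/-- A nonempty edge set without leaves carries a circulation; one with leaves carries a circulation
or a flow between two of its leaves. -/
theorem exists_circulation_or_flow_between_leaves [DecidableEq α] (src tgt : α → V)
    (hne : ∀ e, src e ≠ tgt e) (D : Finset α) (hD : D.Nonempty) :
    (∃ v : α → ℝ, v ≠ 0 ∧ (∀ e, e ∉ D → v e = 0) ∧ netFlow src tgt v = 0) ∨
      ∃ u w, w ≠ u ∧ (∃! e, e ∈ D ∧ (src e = u ∨ tgt e = u)) ∧
        (∃! e, e ∈ D ∧ (src e = w ∨ tgt e = w)) ∧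
        ∃ v : α → ℝ, (∀ e, e ∉ D → v e = 0) ∧
          netFlow src tgt v = Pi.single u 1 - Pi.single w 1 := by
  by_cases hleaf : ∃ u, ∃! e, e ∈ D ∧ (src e = u ∨ tgt e = u)
  · obtain ⟨u, hu⟩ := hleaf
    obtain ⟨e, he, heu⟩ := hu.exists
    rcases exists_circulation_or_flow_to_leaf src tgt hne D u ⟨e, he, heu⟩ with h | ⟨w, hwu, hw, hv⟩
    · exact Or.inl h
    · exact Or.inr ⟨u, w, hwu, hu, hw, hv⟩
  · obtain ⟨e, he⟩ := hD
    rcases exists_circulation_or_flow_to_leaf src tgt hne D (src e) ⟨e, he, Or.inl rfl⟩ with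
      h | ⟨w, -, hw, -⟩
    · exact Or.inl h
    · exact absurd ⟨w, hw⟩ hleaf

end Circulation

section Rounding

variable {B I : Type} [Fintype B] [Fintype I]

open Classical in
/-- The net flow of a bipartite edge vector, with edges directed from the online to the offline
nodes, is the vector of online degrees and of negated offline degrees. -/
theorem netFlow_bipartite (v : B × I → ℝ) :
    netFlow (V := B ⊕ I) (fun e => Sum.inl e.1) (fun e => Sum.inr e.2) v =
      Sum.elim (fun b => ∑ i, v (b, i)) (fun i => -∑ b, v (b, i)) := by
  funext u
  rcases u with b | i
  · simp only [netFlow, Fintype.sum_prod_type]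
    rw [Finset.sum_comm]
    simp
  · simp [netFlow, Fintype.sum_prod_type]

end Rounding

/-- Moving along a line inside a polyhedron from a point with slacks `a` at rates `a'` until a
further constraint becomes tight. -/
theorem exists_step_to_tight {κ : Type} [Fintype κ] (a a' : κ → ℝ) (h0 : ∀ k, 0 ≤ a k)
    (htight : ∀ k, a k = 0 → a' k = 0) (hneg : ∃ k, a' k < 0) :
    ∃ t : ℝ, 0 < t ∧ (∀ k, 0 ≤ a k + t * a' k) ∧ (∃ k, a k ≠ 0 ∧ a k + t * a' k = 0) := by
  classical
  obtain ⟨k₀, hk₀⟩ := hneg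
  obtain ⟨k, hk, hmin⟩ := (Finset.univ.filter fun k => a' k < 0).exists_min_image
    (fun k => a k / -a' k) ⟨k₀, by simpa using hk₀⟩
  simp only [Finset.mem_filter, Finset.mem_univ, true_and] at hk hmin
  have hak : a k ≠ 0 := fun h => hk.ne (htight k h)
  have hpos : 0 < a k := lt_of_le_of_ne (h0 k) hak.symm
  refine ⟨a k / -a' k, div_pos hpos (neg_pos.2 hk), fun l => ?_, k, hak, ?_⟩
  · rcases lt_or_ge (a' l) 0 with hl | hl
    · have := (le_div_iff₀ (neg_pos.2 hl)).1 (hmin l hl)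
      linarith
    · have := mul_nonneg (div_pos hpos (neg_pos.2 hk)).le hl
      linarith [h0 l]
  · have : a' k ≠ 0 := hk.ne
    field_simp
    ring

/-! ### Dependent rounding -/

open Classical in
/-- The directions in which dependent rounding moves the vector of offline degrees: one coordinate
changes, or mass is shifted from one coordinate to another. -/
def IsExchange {I : Type} (v : I → ℝ) : Prop :=
  (∃ i r, v = Pi.single i r) ∨ ∃ i j, i ≠ j ∧ v = Pi.single i 1 - Pi.single j 1

open Classical in
/-- Functions on the unit cube that are convex and quadratic along every exchange direction. -/
def ExchangeConvex {I : Type} (Ψ : (I → ℝ) → ℝ) : Prop :=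
  ∀ d : I → ℝ, (∀ i, 0 ≤ d i ∧ d i ≤ 1) → ∀ v, IsExchange v →
    ∃ a b : ℝ, 0 ≤ a ∧ ∀ t : ℝ, Ψ (fun i => d i + t * v i) = Ψ d + b * t + a * t ^ 2

section Rounding

variable {B I : Type} [Fintype B] [Fintype I]

open Classical in
/-- The indicator of the offline nodes that `M` covers. -/
noncomputable def coverVec (M : Finset (B × I)) (i : I) : ℝ :=
  if Covers M i then 1 else 0

/-- `z` is a fractional matching of the complete bipartite graph. -/
structure IsFractionalMatching (z : B × I → ℝ) : Prop where
  nonneg : ∀ e, 0 ≤ z e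
  online_le_one : ∀ b, ∑ i, z (b, i) ≤ 1
  offline_le_one : ∀ i, ∑ b, z (b, i) ≤ 1

open Classical in
/-- `w` is a probability distribution on the matchings in the support of `z` with edge marginals
`z`, under which the set of covered offline nodes is negatively dependent, in the sense that every
exchange-convex function is at least as large in expectation as at the mean. -/
structure IsDependentRounding (z : B × I → ℝ) (w : Finset (B × I) → ℝ) : Prop where
  nonneg : ∀ M, 0 ≤ w M
  sum_eq_one : ∑ M, w M = 1
  isMatching : ∀ M, w M ≠ 0 → IsMatching M
  support : ∀ M, w M ≠ 0 → ∀ e ∈ M, z e ≠ 0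
  marginal : ∀ e, ∑ M, w M * (if e ∈ M then 1 else 0) = z e
  exchange : ∀ Ψ, ExchangeConvex Ψ → Ψ (fun i => ∑ b, z (b, i)) ≤ ∑ M, w M * Ψ (coverVec M)

theorem IsFractionalMatching.le_one {z : B × I → ℝ} (hz : IsFractionalMatching z) (e : B × I) :
    z e ≤ 1 :=
  (Finset.single_le_sum (f := fun i => z (e.1, i)) (fun _ _ => hz.nonneg _)
    (Finset.mem_univ e.2)).trans (hz.online_le_one e.1)

/-- At a vertex all of whose values sum to at most one, a fractional value excludes a unit one. -/
theorem sum_lt_one_of_unique {κ : Type} [Fintype κ] (f : κ → ℝ) (h0 : ∀ k, 0 ≤ f k)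
    (hsum : ∑ k, f k ≤ 1) (k : κ) (hk : 0 < f k ∧ f k < 1)
    (huniq : ∀ l, 0 < f l ∧ f l < 1 → l = k) : ∑ l, f l < 1 := by
  classical
  have hle : ∀ l, f l ≤ 1 := fun l =>
    (Finset.single_le_sum (f := f) (fun i _ => h0 i) (Finset.mem_univ l)).trans hsum
  rw [Finset.sum_eq_single k]
  · exact hk.2
  · intro l _ hlk
    have hpair : f l + f k ≤ 1 := by
      rw [← Finset.sum_pair hlk]
      exact (Finset.sum_le_sum_of_subset_of_nonneg (Finset.subset_univ _)
        fun i _ _ => h0 i).trans hsum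
    by_contra hne
    exact hlk (huniq l ⟨lt_of_le_of_ne (h0 l) (Ne.symm hne), by linarith [hk.1]⟩)
  · simp

open Classical in
theorem isDependentRounding_of_integral {z : B × I → ℝ} (hz : IsFractionalMatching z)
    (hint : ∀ e, z e = 0 ∨ z e = 1) :
    IsDependentRounding z (Pi.single (Finset.univ.filter fun e => z e = 1) 1) := by
  set M₀ : Finset (B × I) := Finset.univ.filter fun e => z e = 1 with hM₀
  have hmem : ∀ e, e ∈ M₀ ↔ z e = 1 := by simp [hM₀]
  have hw : ∀ M, (Pi.single M₀ 1 : Finset (B × I) → ℝ) M ≠ 0 → M = M₀ := by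
    intro M hM
    by_contra h
    exact hM (by simp [h])
  have hcov : (fun i => ∑ b, z (b, i)) = coverVec M₀ := by
    funext i
    by_cases h : Covers M₀ i
    · obtain ⟨b, hb⟩ := h
      rw [coverVec, if_pos ⟨b, hb⟩]
      refine le_antisymm (hz.offline_le_one i) ?_
      rw [← (hmem _).1 hb]
      exact Finset.single_le_sum (f := fun b => z (b, i)) (fun b _ => hz.nonneg _)
        (Finset.mem_univ b)
    · rw [coverVec, if_neg h]
      refine Finset.sum_eq_zero fun b _ => (hint _).resolve_right fun hb => h ⟨b, (hmem _).2 hb⟩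
  refine ⟨fun M => ?_, by simp, fun M hM => ?_, fun M hM e he => ?_, fun e => ?_, fun Ψ _ => ?_⟩
  · by_cases h : M = M₀ <;> simp [h]
  · rw [hw M hM]
    rintro ⟨b, i⟩ he ⟨b', i'⟩ hf hshare
    rw [hmem] at he hf
    by_contra hne
    rcases hshare with h | h
    · obtain rfl : b = b' := h
      have hii : i ≠ i' := fun h => hne (by rw [h])
      have := (Finset.sum_le_sum_of_subset_of_nonneg (Finset.subset_univ {i, i'})
        fun k _ _ => hz.nonneg (b, k)).trans (hz.online_le_one b)
      rw [Finset.sum_pair hii, he, hf] at this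
      norm_num at this
    · obtain rfl : i = i' := h
      have hbb : b ≠ b' := fun h => hne (by rw [h])
      have := (Finset.sum_le_sum_of_subset_of_nonneg (Finset.subset_univ {b, b'})
        fun k _ _ => hz.nonneg (k, i)).trans (hz.offline_le_one i)
      rw [Finset.sum_pair hbb, he, hf] at this
      norm_num at this
  · rw [hw M hM, hmem] at he
    rw [he]
    exact one_ne_zero
  · rw [Finset.sum_eq_single M₀]
    · rcases hint e with h | h <;> simp [hmem, h]
    · intro M _ h
      simp [h]
    · simp
  · rw [Finset.sum_eq_single M₀]
    · simp [hcov]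
    · intro M _ h
      simp [h]
    · simp

/-- Rounding first along an exchange direction and then dependently from either end. -/
theorem IsDependentRounding.mix {z v : B × I → ℝ} {s t : ℝ} (hs : 0 < s) (ht : 0 < t)
    (hz : IsFractionalMatching z) (hv : ∀ e, z e = 0 → v e = 0)
    (hex : IsExchange fun i => ∑ b, v (b, i)) {w₁ w₂ : Finset (B × I) → ℝ}
    (h₁ : IsDependentRounding (fun e => z e + s * v e) w₁)
    (h₂ : IsDependentRounding (fun e => z e + t * (-v) e) w₂) :
    IsDependentRounding z fun M => t / (s + t) * w₁ M + s / (s + t) * w₂ M := by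
  have hst : 0 < s + t := add_pos hs ht
  have hst' := hst.ne'
  have hsum : ∀ g : Finset (B × I) → ℝ,
      ∑ M, (t / (s + t) * w₁ M + s / (s + t) * w₂ M) * g M =
        t / (s + t) * ∑ M, w₁ M * g M + s / (s + t) * ∑ M, w₂ M * g M := by
    intro g
    rw [Finset.mul_sum, Finset.mul_sum, ← Finset.sum_add_distrib]
    exact Finset.sum_congr rfl fun M _ => by ring
  have hsupp : ∀ M, t / (s + t) * w₁ M + s / (s + t) * w₂ M ≠ 0 → w₁ M ≠ 0 ∨ w₂ M ≠ 0 := by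
    intro M hM
    by_contra! h
    exact hM (by rw [h.1, h.2]; ring)
  refine ⟨fun M => ?_, ?_, fun M hM => ?_, fun M hM e he h0 => ?_, fun e => ?_, fun Ψ hΨ => ?_⟩
  · have := h₁.nonneg M
    have := h₂.nonneg M
    positivity
  · have := hsum fun _ => 1
    simp only [mul_one] at this
    rw [this, h₁.sum_eq_one, h₂.sum_eq_one]
    field_simp
    ring
  · exact (hsupp M hM).elim (h₁.isMatching M) (h₂.isMatching M)
  · rcases hsupp M hM with h | h
    · exact h₁.support M h e he (by simp [h0, hv e h0])
    · exact h₂.support M h e he (by simp [h0, hv e h0])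
  · rw [hsum, h₁.marginal, h₂.marginal, Pi.neg_apply]
    field_simp
    ring
  · rw [hsum]
    have e₁ := h₁.exchange Ψ hΨ
    have e₂ := h₂.exchange Ψ hΨ
    obtain ⟨a, b, ha, hab⟩ := hΨ (fun i => ∑ b, z (b, i))
      (fun i => ⟨Finset.sum_nonneg fun b _ => hz.nonneg _, hz.offline_le_one i⟩) _
      hex
    have d₁ : (fun i => ∑ b, (z (b, i) + s * v (b, i))) =
        fun i => (∑ b, z (b, i)) + s * ∑ b, v (b, i) := by
      funext i
      rw [Finset.sum_add_distrib, Finset.mul_sum]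
    have d₂ : (fun i => ∑ b, (z (b, i) + t * (-v) (b, i))) =
        fun i => (∑ b, z (b, i)) + (-t) * ∑ b, v (b, i) := by
      funext i
      rw [Finset.sum_add_distrib, Finset.mul_sum]
      simp
    rw [d₁, hab] at e₁
    rw [d₂, hab] at e₂
    have k₁ := mul_le_mul_of_nonneg_left e₁ (div_pos ht hst).le
    have k₂ := mul_le_mul_of_nonneg_left e₂ (div_pos hs hst).le
    refine le_trans ?_ (add_le_add k₁ k₂)
    have : t / (s + t) * (Ψ (fun i => ∑ b, z (b, i)) + b * s + a * s ^ 2) +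
        s / (s + t) * (Ψ (fun i => ∑ b, z (b, i)) + b * -t + a * (-t) ^ 2) =
        Ψ (fun i => ∑ b, z (b, i)) + a * (s * t) := by
      field_simp
      ring
    rw [this]
    have := mul_nonneg ha (mul_pos hs ht).le
    linarith

/-- The slacks of the constraints that cut out the fractional matchings. -/
def slack (z : B × I → ℝ) : (B × I) ⊕ (B ⊕ I) → ℝ :=
  Sum.elim z (Sum.elim (fun b => 1 - ∑ i, z (b, i)) (fun i => 1 - ∑ b, z (b, i)))

/-- The rates at which the slacks change in direction `v`. -/
def slackRate (v : B × I → ℝ) : (B × I) ⊕ (B ⊕ I) → ℝ :=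
  Sum.elim v (Sum.elim (fun b => -∑ i, v (b, i)) (fun i => -∑ b, v (b, i)))

theorem slack_add_mul (z v : B × I → ℝ) (t : ℝ) (k) :
    slack (fun e => z e + t * v e) k = slack z k + t * slackRate v k := by
  rcases k with e | b | i <;>
    simp [slack, slackRate, Finset.sum_add_distrib, Finset.mul_sum] <;> ring

theorem isFractionalMatching_iff_slack_nonneg (z : B × I → ℝ) :
    IsFractionalMatching z ↔ ∀ k, 0 ≤ slack z k := by
  constructor
  · rintro ⟨h0, h1, h2⟩ (e | b | i)
    · exact h0 e
    · exact sub_nonneg.2 (h1 b)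
    · exact sub_nonneg.2 (h2 i)
  · intro h
    exact ⟨fun e => h (Sum.inl e), fun b => sub_nonneg.1 (h (Sum.inr (Sum.inl b))),
      fun i => sub_nonneg.1 (h (Sum.inr (Sum.inr i)))⟩

theorem exists_slackRate_neg {v : B × I → ℝ} (hv : v ≠ 0) : ∃ k, slackRate v k < 0 := by
  by_contra! h
  have h0 : ∀ e, 0 ≤ v e := fun e => h (Sum.inl e)
  obtain ⟨⟨b, i⟩, he⟩ := Function.ne_iff.1 hv
  have h1 : 0 ≤ -∑ i, v (b, i) := h (Sum.inr (Sum.inl b))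
  have h2 := Finset.single_le_sum (f := fun i => v (b, i)) (fun i _ => h0 _) (Finset.mem_univ i)
  exact he (le_antisymm (by simpa using h2.trans (neg_nonneg.1 h1)) (h0 _))

open Classical in
/-- A fractional matching that is not integral can be moved both ways along a direction that keeps
all tight constraints tight and changes the offline degrees by an exchange. -/
theorem exists_rounding_direction {z : B × I → ℝ} (hz : IsFractionalMatching z)
    (hfrac : ∃ e, 0 < z e ∧ z e < 1) :
    ∃ v : B × I → ℝ, v ≠ 0 ∧ (∀ k, slack z k = 0 → slackRate v k = 0) ∧
      IsExchange fun i => ∑ b, v (b, i) := by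
  set D : Finset (B × I) := Finset.univ.filter fun e => 0 < z e ∧ z e < 1 with hD
  have hmem : ∀ e, e ∈ D ↔ 0 < z e ∧ z e < 1 := by simp [hD]
  have hedge : ∀ v : B × I → ℝ, (∀ e, e ∉ D → v e = 0) → ∀ e, z e = 0 → v e = 0 :=
    fun v hv e he => hv e fun h => ((hmem e).1 h).1.ne' he
  obtain ⟨e₀, he₀⟩ := hfrac
  rcases exists_circulation_or_flow_between_leaves (V := B ⊕ I) (fun e : B × I => Sum.inl e.1)
    (fun e => Sum.inr e.2) (fun e => Sum.inl_ne_inr) D ⟨e₀, (hmem _).2 he₀⟩ with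
    ⟨v, hv0, hvD, hv⟩ | ⟨u, w, hwu, hu, hw, v, hvD, hv⟩
  · rw [netFlow_bipartite] at hv
    have hB : ∀ b, ∑ i, v (b, i) = 0 := fun b => congrFun hv (Sum.inl b)
    have hI : ∀ i, ∑ b, v (b, i) = 0 := fun i => neg_eq_zero.1 (congrFun hv (Sum.inr i))
    refine ⟨v, hv0, ?_, Or.inl ⟨e₀.2, 0, by funext i; simp [hI]⟩⟩
    rintro (e | b | i) hk
    · exact hedge v hvD e hk
    · simp [slackRate, hB]
    · simp [slackRate, hI]
  · rw [netFlow_bipartite] at hv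
    -- a leaf carries exactly one fractional value, so its constraint is slack
    have hleaf : ∀ k : B ⊕ I, (∃! e, e ∈ D ∧ ((Sum.inl e.1 : B ⊕ I) = k ∨ Sum.inr e.2 = k)) →
        slack z (Sum.inr k) ≠ 0 := by
      rintro (b | i) ⟨⟨b', i'⟩, ⟨he, hk⟩, huniq⟩
      · obtain rfl : b' = b := by simpa using hk
        have := sum_lt_one_of_unique (fun i => z (b', i)) (fun i => hz.nonneg _)
          (hz.online_le_one b') i' ((hmem _).1 he) fun l hl =>
            (Prod.ext_iff.1 (huniq (b', l) ⟨(hmem _).2 hl, Or.inl rfl⟩)).2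
        exact (sub_pos.2 this).ne'
      · obtain rfl : i' = i := by simpa using hk
        have := sum_lt_one_of_unique (fun b => z (b, i')) (fun i => hz.nonneg _)
          (hz.offline_le_one i') b' ((hmem _).1 he) fun l hl =>
            (Prod.ext_iff.1 (huniq (l, i') ⟨(hmem _).2 hl, Or.inr rfl⟩)).1
        exact (sub_pos.2 this).ne'
    have hB : ∀ b, ∑ i, v (b, i) = (Pi.single u 1 - Pi.single w 1 : B ⊕ I → ℝ) (Sum.inl b) :=
      fun b => congrFun hv (Sum.inl b)
    have hI : ∀ i, ∑ b, v (b, i) = -(Pi.single u 1 - Pi.single w 1 : B ⊕ I → ℝ) (Sum.inr i) :=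
      fun i => neg_eq_iff_eq_neg.1 (congrFun hv (Sum.inr i))
    refine ⟨v, ?_, ?_, ?_⟩
    · rintro rfl
      have := congrFun hv u
      rcases u with b | i <;> simp [hwu.symm] at this
    · have hvert : ∀ k : B ⊕ I, slack z (Sum.inr k) = 0 →
          (Pi.single u 1 - Pi.single w 1 : B ⊕ I → ℝ) k = 0 := by
        intro k hk
        have hku : k ≠ u := by rintro rfl; exact hleaf k hu hk
        have hkw : k ≠ w := by rintro rfl; exact hleaf k hw hk
        simp [hku, hkw]
      rintro (e | b | i) hk
      · exact hedge v hvD e hk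
      · simp only [slackRate, Sum.elim_inr, Sum.elim_inl, hB, hvert _ hk, neg_zero]
      · simp only [slackRate, Sum.elim_inr, hI, hvert _ hk, neg_zero]
    · have hfun : (fun i => ∑ b, v (b, i)) =
          fun i => -(Pi.single u 1 - Pi.single w 1 : B ⊕ I → ℝ) (Sum.inr i) := funext hI
      rw [hfun]
      rcases u with b | i <;> rcases w with b' | i'
      · exact Or.inl ⟨e₀.2, 0, by funext i; simp⟩
      · exact Or.inl ⟨i', 1, by funext i; simp [Pi.single_apply]⟩
      · exact Or.inl ⟨i, -1, by funext j; by_cases h : j = i <;> simp [h]⟩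
      · exact Or.inr ⟨i', i, fun h => hwu (by rw [h]), by
          funext j; simp [Pi.single_apply]⟩

open Classical in
/-- Every fractional matching has a dependent rounding. -/
theorem exists_isDependentRounding (z : B × I → ℝ) (hz : IsFractionalMatching z) :
    ∃ w, IsDependentRounding z w := by
  by_cases hfrac : ∃ e, 0 < z e ∧ z e < 1
  · obtain ⟨v, hv0, htight, hex⟩ := exists_rounding_direction hz hfrac
    have hrate : slackRate (-v) = -slackRate v := by
      funext k
      rcases k with e | b | i <;> simp [slackRate]
    have hstep : ∀ v' : B × I → ℝ, v' ≠ 0 → (∀ k, slack z k = 0 → slackRate v' k = 0) →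
        ∃ t : ℝ, 0 < t ∧ IsFractionalMatching (fun e => z e + t * v' e) ∧
          (Finset.univ.filter fun k => slack (fun e => z e + t * v' e) k ≠ 0).card <
            (Finset.univ.filter fun k => slack z k ≠ 0).card := by
      intro v' hv' ht'
      obtain ⟨t, ht, hnn, k, hk0, hk⟩ := exists_step_to_tight (slack z) (slackRate v')
        ((isFractionalMatching_iff_slack_nonneg z).1 hz) ht' (exists_slackRate_neg hv')
      refine ⟨t, ht, (isFractionalMatching_iff_slack_nonneg _).2 fun k => ?_, ?_⟩
      · rw [slack_add_mul]
        exact hnn k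
      · refine Finset.card_lt_card (Finset.ssubset_iff_of_subset ?_ |>.2 ⟨k, ?_, ?_⟩)
        · intro l hl
          rw [Finset.mem_filter] at hl ⊢
          refine ⟨hl.1, fun h0 => hl.2 ?_⟩
          rw [slack_add_mul, h0, ht' l h0]
          simp
        · simpa using hk0
        · simp [slack_add_mul, hk]
    obtain ⟨s, hs, hzs, hcs⟩ := hstep v hv0 htight
    obtain ⟨t, ht, hzt, hct⟩ := hstep (-v) (neg_ne_zero.2 hv0) fun k hk => by
      rw [hrate, Pi.neg_apply, htight k hk, neg_zero]
    obtain ⟨w₁, h₁⟩ := exists_isDependentRounding _ hzs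
    obtain ⟨w₂, h₂⟩ := exists_isDependentRounding _ hzt
    exact ⟨_, IsDependentRounding.mix hs ht hz (fun e he => htight (Sum.inl e) he) hex h₁ h₂⟩
  · refine ⟨_, isDependentRounding_of_integral hz fun e => ?_⟩
    by_contra! h
    exact hfrac ⟨e, lt_of_le_of_ne (hz.nonneg e) h.1.symm, lt_of_le_of_ne (hz.le_one e) h.2⟩
termination_by (Finset.univ.filter fun k => slack z k ≠ 0).card
decreasing_by
  · exact hcs
  · exact hct

end Rounding

/-! ### The multilinear extension of a set function -/

section Multilinear

open scoped Classical

variable {I : Type} [Fintype I]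

/-- The multilinear extension of the set function `f`: the expectation of `f` at the random set
that contains each `i` independently with probability `p i`. -/
noncomputable def multilinear (f : Finset I → ℝ) (p : I → ℝ) : ℝ :=
  ∑ F : Finset I, (∏ i, if i ∈ F then p i else 1 - p i) * f F

theorem multilinear_eq_sum_erase (f : Finset I → ℝ) (p : I → ℝ) (i : I) :
    multilinear f p = ∑ F ∈ (Finset.univ.erase i).powerset,
      (∏ k ∈ Finset.univ.erase i, if k ∈ F then p k else 1 - p k) *
        (p i * f (insert i F) + (1 - p i) * f F) := by
  have huniv : (Finset.univ : Finset (Finset I)) =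
      (insert i (Finset.univ.erase i)).powerset := by
    rw [Finset.insert_erase (Finset.mem_univ i), Finset.powerset_univ]
  rw [multilinear, huniv, Finset.sum_powerset_insert (by simp), ← Finset.sum_add_distrib]
  refine Finset.sum_congr rfl fun F hF => ?_
  have hiF : i ∉ F := fun h => by simpa using Finset.mem_powerset.1 hF h
  rw [← Finset.mul_prod_erase _ _ (Finset.mem_univ i),
    ← Finset.mul_prod_erase _ _ (Finset.mem_univ i), if_neg hiF,
    if_pos (Finset.mem_insert_self i F)]
  have : (∏ k ∈ Finset.univ.erase i, if k ∈ insert i F then p k else 1 - p k) =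
      ∏ k ∈ Finset.univ.erase i, if k ∈ F then p k else 1 - p k := by
    refine Finset.prod_congr rfl fun k hk => ?_
    simp [Finset.ne_of_mem_erase hk]
  rw [this]
  ring

/-- Conditioning on whether the random set contains `i`. -/
theorem multilinear_split (f : Finset I → ℝ) (p : I → ℝ) (i : I) :
    multilinear f p = p i * multilinear (fun F => f (insert i F)) p +
      (1 - p i) * multilinear (fun F => f (F.erase i)) p := by
  rw [multilinear_eq_sum_erase f p i, multilinear_eq_sum_erase (fun F => f (insert i F)) p i,
    multilinear_eq_sum_erase (fun F => f (F.erase i)) p i, Finset.mul_sum, Finset.mul_sum,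
    ← Finset.sum_add_distrib]
  refine Finset.sum_congr rfl fun F hF => ?_
  have hiF : i ∉ F := fun h => by simpa using Finset.mem_powerset.1 hF h
  simp only [Finset.insert_idem, Finset.erase_insert hiF, Finset.erase_eq_of_notMem hiF]
  ring

/-- If `f` does not depend on whether `i` is in the set, its extension ignores the coordinate
`i`. -/
theorem multilinear_congr_of_indep {f : Finset I → ℝ} {i : I}
    (hf : ∀ F, f (insert i F) = f (F.erase i)) {p q : I → ℝ} (hpq : ∀ k, k ≠ i → p k = q k) :
    multilinear f p = multilinear f q := by
  rw [multilinear_eq_sum_erase f p i, multilinear_eq_sum_erase f q i]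
  refine Finset.sum_congr rfl fun F hF => ?_
  have hiF : i ∉ F := fun h => by simpa using Finset.mem_powerset.1 hF h
  rw [hf, Finset.erase_eq_of_notMem hiF]
  have : (∏ k ∈ Finset.univ.erase i, if k ∈ F then p k else 1 - p k) =
      ∏ k ∈ Finset.univ.erase i, if k ∈ F then q k else 1 - q k :=
    Finset.prod_congr rfl fun k hk => by rw [hpq k (Finset.ne_of_mem_erase hk)]
  rw [this]
  ring

theorem multilinear_add (f g : Finset I → ℝ) (p : I → ℝ) :
    multilinear (fun F => f F + g F) p = multilinear f p + multilinear g p := by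
  simp only [multilinear, mul_add, Finset.sum_add_distrib]

theorem multilinear_sub (f g : Finset I → ℝ) (p : I → ℝ) :
    multilinear (fun F => f F - g F) p = multilinear f p - multilinear g p := by
  simp only [multilinear, mul_sub, Finset.sum_sub_distrib]

theorem multilinear_const_mul (c : ℝ) (f : Finset I → ℝ) (p : I → ℝ) :
    multilinear (fun F => c * f F) p = c * multilinear f p := by
  simp only [multilinear, Finset.mul_sum]
  exact Finset.sum_congr rfl fun F _ => by ring

theorem multilinear_sum {κ : Type} (s : Finset κ) (f : κ → Finset I → ℝ) (p : I → ℝ) :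
    multilinear (fun F => ∑ k ∈ s, f k F) p = ∑ k ∈ s, multilinear (f k) p := by
  simp only [multilinear, Finset.mul_sum]
  rw [Finset.sum_comm]

theorem multilinear_const (c : ℝ) (p : I → ℝ) : multilinear (fun _ => c) p = c := by
  have h := Finset.prod_add p (fun i => 1 - p i) Finset.univ
  simp only [add_sub_cancel, Finset.prod_const_one, Finset.powerset_univ] at h
  rw [multilinear, ← Finset.sum_mul]
  have h' : ∑ F : Finset I, (∏ i, if i ∈ F then p i else 1 - p i) = 1 := by
    refine Eq.trans (Finset.sum_congr rfl fun F _ => ?_) h.symm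
    rw [Finset.prod_ite]
    congr 1 <;> refine Finset.prod_congr ?_ fun _ _ => rfl
    · ext; simp
    · ext; simp
  rw [h', one_mul]

/-- Monotonicity of the expectation; only sets that contain all sure elements matter. -/
theorem multilinear_mono {f g : Finset I → ℝ} {p : I → ℝ} (hp : ∀ i, 0 ≤ p i ∧ p i ≤ 1)
    (hfg : ∀ F, (∀ i, p i = 1 → i ∈ F) → f F ≤ g F) : multilinear f p ≤ multilinear g p := by
  refine Finset.sum_le_sum fun F _ => ?_
  by_cases hF : ∀ i, p i = 1 → i ∈ F
  · refine mul_le_mul_of_nonneg_left (hfg F hF) (Finset.prod_nonneg fun i _ => ?_)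
    split_ifs
    · exact (hp i).1
    · exact sub_nonneg.2 (hp i).2
  · push Not at hF
    obtain ⟨i, hi, hiF⟩ := hF
    have : (∏ i, if i ∈ F then p i else 1 - p i) = 0 :=
      Finset.prod_eq_zero (Finset.mem_univ i) (by simp [hiF, hi])
    simp [this]

theorem multilinear_indicator (f : Finset I → ℝ) (A : Finset I) :
    multilinear f (fun i => if i ∈ A then 1 else 0) = f A := by
  rw [multilinear, Finset.sum_eq_single A]
  · rw [Finset.prod_eq_one, one_mul]
    intro i _
    by_cases h : i ∈ A <;> simp [h]
  · intro F _ hFA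
    obtain ⟨i, hi⟩ : ∃ i, ¬(i ∈ F ↔ i ∈ A) := by
      by_contra! h
      exact hFA (Finset.ext h)
    have : (∏ k, if k ∈ F then (if k ∈ A then 1 else 0) else 1 - if k ∈ A then (1 : ℝ) else 0)
        = 0 := by
      refine Finset.prod_eq_zero (Finset.mem_univ i) ?_
      by_cases h1 : i ∈ F <;> by_cases h2 : i ∈ A <;> simp_all
    rw [this, zero_mul]
  · simp

/-- The second difference of `f` in the directions `i` and `j`, at `F` with `i` and `j` removed. -/
noncomputable def secondDiff (f : Finset I → ℝ) (i j : I) (F : Finset I) : ℝ :=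
  f (insert i (insert j F)) - f (insert i (F.erase j)) - f ((insert j F).erase i) +
    f ((F.erase j).erase i)

/-- The multilinear extension as a bilinear function of two coordinates. -/
theorem multilinear_two_coordinates (f : Finset I → ℝ) (p : I → ℝ) {i j : I} (hij : i ≠ j) :
    ∃ b₁ b₂ : ℝ, ∀ s r : ℝ, multilinear f (fun k => p k + s * (Pi.single i 1 : I → ℝ) k +
        r * (Pi.single j 1 : I → ℝ) k) =
      multilinear f p + b₁ * s + b₂ * r + multilinear (secondDiff f i j) p * (s * r) := by
  set App := multilinear (fun F => f (insert i (insert j F))) p with hpp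
  set Apm := multilinear (fun F => f (insert i (F.erase j))) p with hpm
  set Amp := multilinear (fun F => f ((insert j F).erase i)) p with hmp
  set Amm := multilinear (fun F => f ((F.erase j).erase i)) p with hmm
  have key : ∀ q : I → ℝ, (∀ k, k ≠ i → k ≠ j → q k = p k) →
      multilinear f q = q i * q j * App + q i * (1 - q j) * Apm + (1 - q i) * q j * Amp +
        (1 - q i) * (1 - q j) * Amm := by
    intro q hq
    have hind : ∀ h : Finset I → ℝ, (∀ F, h (insert i F) = h (F.erase i)) →
        (∀ F, h (insert j F) = h (F.erase j)) → multilinear h q = multilinear h p := by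
      intro h hi hj
      rw [multilinear_congr_of_indep hi (q := fun k => if k = j then q k else p k),
        multilinear_congr_of_indep hj]
      · intro k hk
        simp [hk]
      · intro k hk
        by_cases hkj : k = j
        · simp [hkj]
        · simp [hkj, hq k hk hkj]
    have hji := hij.symm
    rw [multilinear_split f q i, multilinear_split (fun F => f (insert i F)) q j,
      multilinear_split (fun F => f (F.erase i)) q j, hpp, hpm, hmp, hmm,
      hind (fun F => f (insert i (insert j F))), hind (fun F => f (insert i (F.erase j))),
      hind (fun F => f ((insert j F).erase i)), hind (fun F => f ((F.erase j).erase i))]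
    · ring
    all_goals
      intro F
      congr 1
      ext k
      simp only [Finset.mem_insert, Finset.mem_erase]
      by_cases h1 : k = i <;> by_cases h2 : k = j <;> simp_all
  have hD : multilinear (secondDiff f i j) p = App - Apm - Amp + Amm := by
    rw [show secondDiff f i j = fun F => f (insert i (insert j F)) - f (insert i (F.erase j)) -
      f ((insert j F).erase i) + f ((F.erase j).erase i) from rfl, multilinear_add,
      multilinear_sub, multilinear_sub]
  refine ⟨p j * App + (1 - p j) * Apm - p j * Amp - (1 - p j) * Amm,
    p i * App - p i * Apm + (1 - p i) * Amp - (1 - p i) * Amm, fun s r => ?_⟩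
  rw [key, key p fun _ _ _ => rfl, hD]
  · simp only [Pi.single_eq_same, Pi.single_eq_of_ne hij, Pi.single_eq_of_ne hij.symm]
    ring
  · intro k hki hkj
    simp [hki, hkj]

/-- Functions of disjoint sets of coordinates are independent. -/
theorem multilinear_mul_of_disjoint (N : Finset I) (h : Finset I → ℝ) (hh : ∀ F, h F = h (F \ N))
    (p : I → ℝ) : ∀ S ⊆ N, ∀ a : Finset I → ℝ, (∀ F, a F = a (F ∩ S)) →
      multilinear (fun F => a F * h F) p = multilinear a p * multilinear h p := by
  intro S
  induction S using Finset.induction_on with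
  | empty =>
    intro _ a ha
    have : a = fun _ => a ∅ := funext fun F => by rw [ha F, Finset.inter_empty]
    rw [this, multilinear_const_mul, multilinear_const]
  | insert i S hiS ih =>
    intro hSN a ha
    have hiN : i ∈ N := hSN (Finset.mem_insert_self i S)
    have hSN' : S ⊆ N := (Finset.subset_insert i S).trans hSN
    have h1 : ∀ F, h (insert i F) = h F := fun F => by
      rw [hh, hh F, Finset.insert_sdiff_of_mem _ hiN]
    have h2 : ∀ F, h (F.erase i) = h F := fun F => by
      rw [hh, hh F]
      congr 1
      ext k
      simp only [Finset.mem_sdiff, Finset.mem_erase]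
      by_cases hk : k = i <;> simp_all
    rw [multilinear_split _ p i, multilinear_split a p i]
    simp only [h1, h2]
    rw [ih hSN' (fun F => a (insert i F)), ih hSN' (fun F => a (F.erase i))]
    · ring
    all_goals
      intro F
      rw [ha, ha (_ : Finset I)]
      congr 1
      ext k
      simp only [Finset.mem_inter, Finset.mem_insert, Finset.mem_erase]
      by_cases hk : k = i <;> simp_all

/-- Conditioning on the part of the random set outside `N`. -/
theorem multilinear_eq_sum_condition (N : Finset I) (Φ : Finset I → Finset I → ℝ) (p : I → ℝ) :
    multilinear (fun F => Φ (F \ N) (F ∩ N)) p =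
      ∑ R : Finset I, multilinear (fun F => if F \ N = R then 1 else 0) p *
        multilinear (fun F => Φ R (F ∩ N)) p := by
  have : (fun F => Φ (F \ N) (F ∩ N)) =
      fun F => ∑ R : Finset I, Φ R (F ∩ N) * (if F \ N = R then 1 else 0) := by
    funext F
    simp
  rw [this, multilinear_sum]
  refine Finset.sum_congr rfl fun R _ => ?_
  rw [multilinear_mul_of_disjoint N (fun F => if F \ N = R then 1 else 0) (by simp) p N subset_rfl
    (fun F => Φ R (F ∩ N)) (by simp [Finset.inter_assoc]), mul_comm]

theorem multilinear_disjoint (p : I → ℝ) (S : Finset I) :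
    multilinear (fun F => if F ∩ S = ∅ then 1 else 0) p = ∏ i ∈ S, (1 - p i) := by
  induction S using Finset.induction_on with
  | empty => simpa using multilinear_const 1 p
  | insert i S hiS ih =>
    rw [multilinear_split _ p i, Finset.prod_insert hiS, ← ih]
    have h1 : ∀ F : Finset I, insert i F ∩ insert i S ≠ ∅ := fun F =>
      Finset.Nonempty.ne_empty ⟨i, by simp⟩
    have h2 : ∀ F : Finset I, F.erase i ∩ insert i S = F ∩ S := fun F => by
      ext k
      simp only [Finset.mem_inter, Finset.mem_insert, Finset.mem_erase]
      by_cases hk : k = i <;> simp_all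
    simp only [h1, h2, if_false, multilinear_const]
    ring

end Multilinear

/-! ### Maximum weight matchings and their submodularity -/

section MatchingValue

open scoped Classical

variable {B I : Type}

theorem IsMatching.subset {M N : Finset (B × I)} (hM : IsMatching M) (h : N ⊆ M) : IsMatching N :=
  fun e he f hf => hM e (h he) f (h hf)

theorem isMatching_empty : IsMatching (∅ : Finset (B × I)) := by
  simp [IsMatching]

theorem IsMatching.sum_online_le_one [Fintype I] {M : Finset (B × I)} (hM : IsMatching M) (b : B) :
    ∑ i, (if (b, i) ∈ M then (1 : ℝ) else 0) ≤ 1 := by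
  rw [Finset.sum_boole]
  exact_mod_cast Finset.card_le_one.2 fun i hi j hj => by
    simpa using hM _ (Finset.mem_filter.1 hi).2 _ (Finset.mem_filter.1 hj).2 (Or.inl rfl)

theorem IsMatching.sum_offline_le_one [Fintype B] {M : Finset (B × I)} (hM : IsMatching M) (i : I) :
    ∑ b, (if (b, i) ∈ M then (1 : ℝ) else 0) ≤ 1 := by
  rw [Finset.sum_boole]
  exact_mod_cast Finset.card_le_one.2 fun b hb b' hb' => by
    simpa using hM _ (Finset.mem_filter.1 hb).2 _ (Finset.mem_filter.1 hb').2 (Or.inr rfl)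

theorem coverVec_eq_sum [Fintype B] {M : Finset (B × I)} (hM : IsMatching M) (i : I) :
    coverVec M i = ∑ b, if (b, i) ∈ M then 1 else 0 := by
  by_cases h : Covers M i
  · rw [coverVec, if_pos h]
    obtain ⟨b, hb⟩ := h
    rw [Finset.sum_eq_single b]
    · rw [if_pos hb]
    · intro b' _ hne
      rw [if_neg]
      intro hb'
      exact hne (Prod.ext_iff.1 (hM _ hb' _ hb (Or.inr rfl))).1
    · simp
  · rw [coverVec, if_neg h]
    exact (Finset.sum_eq_zero fun b _ => if_neg fun hb => h ⟨b, hb⟩).symm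

theorem coverVec_eq_zero_or_one (M : Finset (B × I)) (i : I) :
    coverVec M i = 0 ∨ coverVec M i = 1 := by
  rw [coverVec]
  split_ifs <;> simp

theorem sum_mul_coverVec [Fintype B] [Fintype I] {M : Finset (B × I)} (hM : IsMatching M)
    (a : I → ℝ) : ∑ i, a i * coverVec M i = ∑ e ∈ M, a e.2 := by
  have : ∀ i, a i * coverVec M i = ∑ b, if (b, i) ∈ M then a i else 0 := fun i => by
    rw [coverVec_eq_sum hM, Finset.mul_sum]
    simp
  simp only [this]
  rw [Finset.sum_comm, ← Fintype.sum_prod_type' (f := fun b i => if (b, i) ∈ M then a i else 0)]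
  simp

theorem exchangeConvex_neg_mul {i j : I} (hij : i ≠ j) :
    ExchangeConvex fun d : I → ℝ => -(d i * d j) := by
  intro d _ v hv
  refine ⟨-(v i * v j), -(d i * v j + v i * d j), ?_, fun t => by ring⟩
  rcases hv with ⟨k, r, rfl⟩ | ⟨k, l, hkl, rfl⟩
  · by_cases h : i = k
    · simp [← h, hij.symm]
    · simp [h]
  · by_cases h1 : i = k <;> by_cases h2 : i = l <;> by_cases h3 : j = k <;> by_cases h4 : j = l <;>
      simp_all

theorem secondDiff_eq (f : Finset I → ℝ) {i j : I} (hij : i ≠ j) (F : Finset I) :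
    secondDiff f i j F = f (insert i (insert j ((F.erase j).erase i))) -
      f (insert i ((F.erase j).erase i)) - f (insert j ((F.erase j).erase i)) +
        f ((F.erase j).erase i) := by
  have h1 : insert i (insert j F) = insert i (insert j ((F.erase j).erase i)) := by
    ext k; by_cases hk : k = i <;> by_cases hk' : k = j <;> simp [hk, hk']
  have h2 : insert i (F.erase j) = insert i ((F.erase j).erase i) := by
    ext k; by_cases hk : k = i <;> simp [hk]
  have h3 : (insert j F).erase i = insert j ((F.erase j).erase i) := by
    ext k; by_cases hk : k = i <;> by_cases hk' : k = j <;> simp_all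
  rw [secondDiff, h1, h2, h3]

variable [Fintype B] [Fintype I]

/-- The maximum `ℓ`-weight of a matching inside `D` that uses only offline nodes of `F`. -/
noncomputable def matchValue (D : Finset (B × I)) (ℓ : B × I → ℝ) (F : Finset I) : ℝ :=
  (D.powerset.filter fun M => IsMatching M ∧ ∀ e ∈ M, e.2 ∈ F).sup'
    ⟨∅, by simp [isMatching_empty]⟩ fun M => ∑ e ∈ M, ℓ e

theorem le_matchValue {D M : Finset (B × I)} {ℓ : B × I → ℝ} {F : Finset I} (hMD : M ⊆ D)
    (hM : IsMatching M) (hMF : ∀ e ∈ M, e.2 ∈ F) : ∑ e ∈ M, ℓ e ≤ matchValue D ℓ F :=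
  Finset.le_sup' (fun M => ∑ e ∈ M, ℓ e) (by simp [hMD, hM]; simpa using hMF)

theorem exists_matchValue_eq (D : Finset (B × I)) (ℓ : B × I → ℝ) (F : Finset I) :
    ∃ M, M ⊆ D ∧ IsMatching M ∧ (∀ e ∈ M, e.2 ∈ F) ∧ matchValue D ℓ F = ∑ e ∈ M, ℓ e := by
  obtain ⟨M, hM, h⟩ := Finset.exists_mem_eq_sup' (s := D.powerset.filter fun M =>
    IsMatching M ∧ ∀ e ∈ M, e.2 ∈ F) ⟨∅, by simp [isMatching_empty]⟩ fun M => ∑ e ∈ M, ℓ e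
  rw [Finset.mem_filter, Finset.mem_powerset] at hM
  exact ⟨M, hM.1, hM.2.1, hM.2.2, h⟩

theorem matchValue_mono {D D' : Finset (B × I)} {ℓ : B × I → ℝ} {F F' : Finset I} (hD : D ⊆ D')
    (hF : ∀ e ∈ D, e.2 ∈ F → e.2 ∈ F') : matchValue D ℓ F ≤ matchValue D' ℓ F' := by
  obtain ⟨M, hMD, hM, hMF, h⟩ := exists_matchValue_eq D ℓ F
  rw [h]
  exact le_matchValue (hMD.trans hD) hM fun e he => hF e (hMD he) (hMF e he)

/-- One more offline node adds at most the largest weight of an edge at that node. -/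
theorem matchValue_insert_le {D : Finset (B × I)} {ℓ : B × I → ℝ} {i : I} {L : ℝ} (hL : 0 ≤ L)
    (hℓ : ∀ b, ℓ (b, i) ≤ L) (F : Finset I) :
    matchValue D ℓ (insert i F) ≤ matchValue D ℓ F + L := by
  obtain ⟨M, hMD, hM, hMF, h⟩ := exists_matchValue_eq D ℓ (insert i F)
  rw [h, ← Finset.sum_filter_add_sum_filter_not M (fun e => e.2 ≠ i)]
  refine add_le_add (le_matchValue ((Finset.filter_subset _ _).trans hMD)
    (hM.subset (Finset.filter_subset _ _)) fun e he => ?_) ?_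
  · rw [Finset.mem_filter] at he
    exact Finset.mem_of_mem_insert_of_ne (hMF e he.1) he.2
  · have hcard : (M.filter fun e => ¬e.2 ≠ i).card ≤ 1 := Finset.card_le_one.2 fun e he f hf => by
      simp only [ne_eq, not_not, Finset.mem_filter] at he hf
      exact hM e he.1 f hf.1 (Or.inr (he.2.trans hf.2.symm))
    refine (Finset.sum_le_card_nsmul _ _ L fun e he => ?_).trans ?_
    · simp only [ne_eq, not_not, Finset.mem_filter] at he
      rw [← he.2] at hℓ
      exact hℓ e.1
    · rw [nsmul_eq_mul]
      exact mul_le_of_le_one_left hL (by exact_mod_cast hcard)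

/-- If the edges of `s` exclude one another in every outcome of a rounding and their values sum to
one, then every outcome contains one of them. -/
theorem IsDependentRounding.exists_mem {z : B × I → ℝ} {w : Finset (B × I) → ℝ}
    (hw : IsDependentRounding z w) (s : Finset (B × I)) (hs : ∑ e ∈ s, z e = 1)
    (hexcl : ∀ e ∈ s, ∀ f ∈ s, e.1 = f.1 ∨ e.2 = f.2) {N : Finset (B × I)} (hN : w N ≠ 0) :
    ∃ e ∈ s, e ∈ N := by
  have hsum : ∑ M, w M * (1 - ∑ e ∈ s, if e ∈ M then 1 else 0) = 0 := by
    simp only [mul_sub, Finset.sum_sub_distrib, mul_one, hw.sum_eq_one, Finset.mul_sum]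
    rw [Finset.sum_comm, Finset.sum_congr rfl fun e _ => hw.marginal e, hs, sub_self]
  have hnn : ∀ M ∈ Finset.univ, 0 ≤ w M * (1 - ∑ e ∈ s, if e ∈ M then (1 : ℝ) else 0) := by
    intro M _
    by_cases hM : w M = 0
    · simp [hM]
    · refine mul_nonneg (hw.nonneg M) (sub_nonneg.2 ?_)
      rw [Finset.sum_boole]
      exact_mod_cast Finset.card_le_one.2 fun e he f hf => by
        rw [Finset.mem_filter] at he hf
        exact hw.isMatching M hM e he.2 f hf.2 (hexcl e he.1 f hf.1)
  have h0 := (Finset.sum_eq_zero_iff_of_nonneg hnn).1 hsum N (Finset.mem_univ N)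
  by_contra! hno
  rw [Finset.sum_eq_zero fun e he => if_neg (hno e he)] at h0
  simp [hN] at h0

theorem IsDependentRounding.sum_coverVec {z : B × I → ℝ} {w : Finset (B × I) → ℝ}
    (hw : IsDependentRounding z w) (i : I) : ∑ M, w M * coverVec M i = ∑ b, z (b, i) := by
  have : ∀ M, w M * coverVec M i = ∑ b, w M * if (b, i) ∈ M then 1 else 0 := by
    intro M
    by_cases hM : w M = 0
    · simp [hM]
    · rw [coverVec_eq_sum (hw.isMatching M hM), Finset.mul_sum]
  rw [Finset.sum_congr rfl fun M _ => this M, Finset.sum_comm]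
  exact Finset.sum_congr rfl fun b _ => hw.marginal (b, i)

/-- The union of a matching `M` on `X` and a matching `M'` that also covers `i` and `j` can be
redistributed into a matching `N` that covers exactly one of `i` and `j` and a matching that covers
only the other one. Such an `N` occurs as an outcome of rounding `(M + M') / 2`, because `i` and `j`
are both covered with probability at most `1 / 4`, but each with probability `1 / 2`. -/
theorem exists_redistribution {M M' : Finset (B × I)} (hM : IsMatching M) (hM' : IsMatching M')
    {i j : I} (hij : i ≠ j) (hMi : ¬Covers M i) (hMj : ¬Covers M j) (hi : Covers M' i)
    (hj : Covers M' j) :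
    ∃ N N' : Finset (B × I), IsMatching N ∧ IsMatching N' ∧ N ⊆ M ∪ M' ∧ N' ⊆ M ∪ M' ∧
      (∀ ℓ : B × I → ℝ, ∑ e ∈ N, ℓ e + ∑ e ∈ N', ℓ e = ∑ e ∈ M, ℓ e + ∑ e ∈ M', ℓ e) ∧
      ¬Covers N j ∧ ¬Covers N' i := by
  suffices H : ∃ N N' : Finset (B × I), IsMatching N ∧ IsMatching N' ∧ N ⊆ M ∪ M' ∧ N' ⊆ M ∪ M' ∧
      (∀ ℓ : B × I → ℝ, ∑ e ∈ N, ℓ e + ∑ e ∈ N', ℓ e = ∑ e ∈ M, ℓ e + ∑ e ∈ M', ℓ e) ∧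
      ((¬Covers N j ∧ ¬Covers N' i) ∨ (¬Covers N i ∧ ¬Covers N' j)) by
    obtain ⟨N, N', hN, hN', hs, hs', hsum, h | h⟩ := H
    · exact ⟨N, N', hN, hN', hs, hs', hsum, h⟩
    · exact ⟨N', N, hN', hN, hs', hs, fun ℓ => by rw [add_comm, hsum], h.2, h.1⟩
  set z : B × I → ℝ := fun e => ((if e ∈ M then 1 else 0) + if e ∈ M' then 1 else 0) / 2 with hz
  have hzfrac : IsFractionalMatching z := by
    refine ⟨fun e => ?_, fun b => ?_, fun i => ?_⟩
    · simp only [hz]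
      split_ifs <;> norm_num
    · simp only [hz, ← Finset.sum_div, Finset.sum_add_distrib]
      linarith [hM.sum_online_le_one b, hM'.sum_online_le_one b]
    · simp only [hz, ← Finset.sum_div, Finset.sum_add_distrib]
      linarith [hM.sum_offline_le_one i, hM'.sum_offline_le_one i]
  obtain ⟨w, hw⟩ := exists_isDependentRounding z hzfrac
  have hdeg : ∀ k, ¬Covers M k → Covers M' k → ∑ b, z (b, k) = 1 / 2 := by
    intro k hk hk'
    simp only [hz, ← Finset.sum_div, Finset.sum_add_distrib]
    rw [← coverVec_eq_sum hM, ← coverVec_eq_sum hM', coverVec, coverVec, if_neg hk, if_pos hk']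
    norm_num
  obtain ⟨N, hN, hNij⟩ : ∃ N, w N ≠ 0 ∧ coverVec N i ≠ coverVec N j := by
    by_contra! h
    have h1 := hw.exchange _ (exchangeConvex_neg_mul hij)
    simp only [hdeg i hMi hi, hdeg j hMj hj] at h1
    have h2 : ∑ N, w N * -(coverVec N i * coverVec N j) = -∑ N, w N * coverVec N i := by
      rw [← Finset.sum_neg_distrib]
      refine Finset.sum_congr rfl fun N _ => ?_
      by_cases hN : w N = 0
      · simp [hN]
      · rw [← h N hN, coverVec]
        split_ifs <;> simp
    rw [h2, hw.sum_coverVec, hdeg i hMi hi] at h1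
    norm_num at h1
  have hNsub : N ⊆ M ∪ M' := by
    intro e he
    have := hw.support N hN e he
    rw [Finset.mem_union]
    by_contra! h
    exact this (by simp [hz, h.1, h.2])
  have hboth : M ∩ M' ⊆ N := by
    intro e he
    rw [Finset.mem_inter] at he
    obtain ⟨f, hf, hfN⟩ := hw.exists_mem {e} (by simp [hz, he.1, he.2])
      (by simp) hN
    rwa [Finset.mem_singleton.1 hf] at hfN
  have hcross : ∀ e ∈ M, ∀ f ∈ M', e ≠ f → (e.1 = f.1 ∨ e.2 = f.2) → e ∈ N ∨ f ∈ N := by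
    intro e he f hf hef hshare
    have heM' : e ∉ M' := fun h => hef (hM' e h f hf hshare)
    have hfM : f ∉ M := fun h => hef (hM e he f h hshare)
    obtain ⟨g, hg, hgN⟩ := hw.exists_mem {e, f}
      (by rw [Finset.sum_pair hef]; simp [hz, he, hf, heM', hfM]; norm_num)
      (by
        simp only [Finset.mem_insert, Finset.mem_singleton]
        rintro a (rfl | rfl) c (rfl | rfl)
        · exact Or.inl rfl
        · exact hshare
        · exact hshare.imp Eq.symm Eq.symm
        · exact Or.inl rfl) hN
    rw [Finset.mem_insert, Finset.mem_singleton] at hg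
    rcases hg with rfl | rfl
    · exact Or.inl hgN
    · exact Or.inr hgN
  have hnot : ∀ k, ¬Covers M k → Covers M' k → Covers N k →
      ¬Covers (M ∩ M' ∪ (M ∪ M') \ N) k := by
    rintro k hk - ⟨b, hb⟩ ⟨b', hb'⟩
    have hM'only : ∀ c, (c, k) ∈ M ∪ M' → (c, k) ∈ M' := fun c hc =>
      (Finset.mem_union.1 hc).resolve_left fun h => hk ⟨c, h⟩
    have hb'U : (b', k) ∈ M ∪ M' := by
      rcases Finset.mem_union.1 hb' with h | h
      · exact Finset.mem_union_left _ (Finset.mem_inter.1 h).1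
      · exact (Finset.mem_sdiff.1 h).1
    have := hM' _ (hM'only b (hNsub hb)) _ (hM'only b' hb'U) (Or.inr rfl)
    rw [← this] at hb'
    rcases Finset.mem_union.1 hb' with h | h
    · exact hk ⟨b, (Finset.mem_inter.1 h).1⟩
    · exact (Finset.mem_sdiff.1 h).2 hb
  refine ⟨N, M ∩ M' ∪ (M ∪ M') \ N, hw.isMatching N hN, ?_, hNsub, ?_, fun ℓ => ?_, ?_⟩
  · have hmem : ∀ e, e ∈ M ∩ M' ∪ (M ∪ M') \ N ↔ (e ∈ M ∧ e ∈ M') ∨ ((e ∈ M ∨ e ∈ M') ∧ e ∉ N) := by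
      simp
    intro e he f hf hshare
    rw [hmem] at he hf
    by_contra hef
    have hshare' : f.1 = e.1 ∨ f.2 = e.2 := hshare.imp Eq.symm Eq.symm
    have hMM : e ∈ M → f ∉ M := fun h h' => hef (hM e h f h' hshare)
    have hMM' : e ∈ M' → f ∉ M' := fun h h' => hef (hM' e h f h' hshare)
    have hc1 : e ∈ M → f ∈ M' → e ∈ N ∨ f ∈ N := fun h h' => hcross e h f h' hef hshare
    have hc2 : e ∈ M' → f ∈ M → e ∈ N ∨ f ∈ N := fun h h' =>
      (hcross f h' e h (Ne.symm hef) hshare').symm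
    rcases he with ⟨he, he'⟩ | ⟨he | he, heN⟩ <;> rcases hf with ⟨hf, hf'⟩ | ⟨hf | hf, hfN⟩
    · exact hMM he hf
    · exact hMM he hf
    · exact hMM' he' hf
    · exact hMM he hf
    · exact hMM he hf
    · exact (hc1 he hf).elim heN hfN
    · exact hMM' he hf'
    · exact (hc2 he hf).elim heN hfN
    · exact hMM' he hf
  · intro e he
    simp only [Finset.mem_union, Finset.mem_inter, Finset.mem_sdiff] at he ⊢
    tauto
  · have hind : ∀ S : Finset (B × I), ∑ e ∈ S, ℓ e = ∑ e, if e ∈ S then ℓ e else 0 := by simp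
    rw [hind N, hind (M ∩ M' ∪ _), hind M, hind M', ← Finset.sum_add_distrib,
      ← Finset.sum_add_distrib]
    refine Finset.sum_congr rfl fun e _ => ?_
    have h1 : e ∈ N → e ∈ M ∨ e ∈ M' := fun h => Finset.mem_union.1 (hNsub h)
    have h2 : e ∈ M → e ∈ M' → e ∈ N := fun h h' => hboth (Finset.mem_inter.2 ⟨h, h'⟩)
    by_cases ha : e ∈ N <;> by_cases hb : e ∈ M <;> by_cases hc : e ∈ M' <;>
      simp only [ha, hb, hc, Finset.mem_union, Finset.mem_inter, Finset.mem_sdiff, if_true,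
        if_false, and_self, and_true, or_true, or_false, or_self, and_false, not_true,
        not_false_iff, add_zero, zero_add]
    · exact absurd (h1 ha) (by simp [hb, hc])
    · exact absurd (h2 hb hc) ha
  · by_cases hNi : Covers N i <;> by_cases hNj : Covers N j
    · exact absurd (by simp [coverVec, hNi, hNj]) hNij
    · exact Or.inl ⟨hNj, hnot i hMi hi hNi⟩
    · exact Or.inr ⟨hNi, hnot j hMj hj hNj⟩
    · exact absurd (by simp [coverVec, hNi, hNj]) hNij

/-- The matching value is a submodular function of the set of offline nodes. -/
theorem matchValue_submodular (D : Finset (B × I)) (ℓ : B × I → ℝ) {i j : I} (hij : i ≠ j)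
    {X : Finset I} (hi : i ∉ X) (hj : j ∉ X) :
    matchValue D ℓ (insert i (insert j X)) + matchValue D ℓ X ≤
      matchValue D ℓ (insert i X) + matchValue D ℓ (insert j X) := by
  obtain ⟨M, hMD, hM, hMF, h⟩ := exists_matchValue_eq D ℓ X
  obtain ⟨M', hMD', hM', hMF', h'⟩ := exists_matchValue_eq D ℓ (insert i (insert j X))
  rw [h, h']
  have hXi : matchValue D ℓ X ≤ matchValue D ℓ (insert i X) :=
    matchValue_mono subset_rfl fun e _ he => Finset.mem_insert_of_mem he
  have hXj : matchValue D ℓ X ≤ matchValue D ℓ (insert j X) :=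
    matchValue_mono subset_rfl fun e _ he => Finset.mem_insert_of_mem he
  rw [h] at hXi hXj
  by_cases hci : Covers M' i
  · by_cases hcj : Covers M' j
    · obtain ⟨N, N', hN, hN', hNs, hNs', hsum, hNj, hNi'⟩ := exists_redistribution hM hM' hij
        (fun ⟨b, hb⟩ => hi (hMF _ hb)) (fun ⟨b, hb⟩ => hj (hMF _ hb)) hci hcj
      have hU : M ∪ M' ⊆ D := Finset.union_subset hMD hMD'
      have hUF : ∀ e ∈ M ∪ M', e.2 = i ∨ e.2 = j ∨ e.2 ∈ X := by
        intro e he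
        rcases Finset.mem_union.1 he with he | he
        · exact Or.inr (Or.inr (hMF e he))
        · simpa using hMF' e he
      have h1 : ∑ e ∈ N, ℓ e ≤ matchValue D ℓ (insert i X) :=
        le_matchValue (hNs.trans hU) hN fun e he => by
          rcases hUF e (hNs he) with h | h | h
          · simp [h]
          · exact absurd ⟨e.1, h ▸ he⟩ hNj
          · simp [h]
      have h2 : ∑ e ∈ N', ℓ e ≤ matchValue D ℓ (insert j X) :=
        le_matchValue (hNs'.trans hU) hN' fun e he => by
          rcases hUF e (hNs' he) with h | h | h
          · exact absurd ⟨e.1, h ▸ he⟩ hNi'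
          · simp [h]
          · simp [h]
      linarith [hsum ℓ]
    · have : ∑ e ∈ M', ℓ e ≤ matchValue D ℓ (insert i X) :=
        le_matchValue hMD' hM' fun e he => by
          have := hMF' e he
          simp only [Finset.mem_insert] at this ⊢
          rcases this with h | h | h
          · exact Or.inl h
          · exact absurd ⟨e.1, h ▸ he⟩ hcj
          · exact Or.inr h
      linarith
  · have : ∑ e ∈ M', ℓ e ≤ matchValue D ℓ (insert j X) :=
      le_matchValue hMD' hM' fun e he => by
        have := hMF' e he
        simp only [Finset.mem_insert] at this ⊢
        rcases this with h | h | h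
        · exact absurd ⟨e.1, h ▸ he⟩ hci
        · exact Or.inl h
        · exact Or.inr h
    linarith

theorem secondDiff_matchValue_nonpos (D : Finset (B × I)) (ℓ : B × I → ℝ) {i j : I} (hij : i ≠ j)
    (F : Finset I) : secondDiff (matchValue D ℓ) i j F ≤ 0 := by
  rw [secondDiff_eq _ hij]
  linarith [matchValue_submodular D ℓ hij (X := (F.erase j).erase i) (by simp) (by simp)]

theorem neg_le_secondDiff_matchValue {D : Finset (B × I)} {ℓ : B × I → ℝ} {i j : I} (hij : i ≠ j)
    {L : ℝ} (hL : 0 ≤ L) (hℓ : (∀ b, ℓ (b, i) ≤ L) ∨ ∀ b, ℓ (b, j) ≤ L) (F : Finset I) :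
    -L ≤ secondDiff (matchValue D ℓ) i j F := by
  rw [secondDiff_eq _ hij]
  set X := (F.erase j).erase i
  have h1 : matchValue D ℓ (insert i X) ≤ matchValue D ℓ (insert i (insert j X)) :=
    matchValue_mono subset_rfl fun e _ he => by
      rw [Finset.mem_insert] at he
      simp [he.imp_right Or.inr]
  have h2 : matchValue D ℓ (insert j X) ≤ matchValue D ℓ (insert i (insert j X)) :=
    matchValue_mono subset_rfl fun e _ he => Finset.mem_insert_of_mem he
  rcases hℓ with hℓ | hℓ
  · linarith [matchValue_insert_le (D := D) hL hℓ X]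
  · linarith [matchValue_insert_le (D := D) hL hℓ X]

end MatchingValue

/-! ### Set functions of the rounded first batch -/

section NegativeDependence

open scoped Classical

variable {B I : Type} [Fintype B] [Fintype I]

theorem multilinear_one_coordinate (f : Finset I → ℝ) (p : I → ℝ) (i : I) :
    ∃ b : ℝ, ∀ s : ℝ, multilinear f (fun k => p k + s * (Pi.single i 1 : I → ℝ) k) =
      multilinear f p + b * s := by
  refine ⟨multilinear (fun F => f (insert i F)) p - multilinear (fun F => f (F.erase i)) p,
    fun s => ?_⟩
  rw [multilinear_split f _ i, multilinear_split f p i,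
    multilinear_congr_of_indep (i := i) (f := fun F => f (insert i F)) (q := p),
    multilinear_congr_of_indep (i := i) (f := fun F => f (F.erase i)) (q := p)]
  · simp only [Pi.single_eq_same]
    ring
  · intro F
    rw [Finset.erase_idem, Finset.erase_insert_eq_erase]
  · intro k hk
    simp [hk]
  · intro F
    congr 1
    ext k
    by_cases hk : k = i <;> simp [hk]
  · intro k hk
    simp [hk]

/-- Along a shift of mass from `j` to `i`, the curvature of a multilinear extension is minus an
expected second difference. -/
theorem multilinear_shift (f : Finset I → ℝ) (α β d : I → ℝ) {i j : I} (hij : i ≠ j) :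
    ∃ b : ℝ, ∀ t : ℝ,
      multilinear f (fun k => α k + β k * (d k + t * (Pi.single i 1 - Pi.single j 1 : I → ℝ) k)) =
        multilinear f (fun k => α k + β k * d k) + b * t -
          β i * β j * multilinear (secondDiff f i j) (fun k => α k + β k * d k) * t ^ 2 := by
  obtain ⟨b₁, b₂, h⟩ := multilinear_two_coordinates f (fun k => α k + β k * d k) hij
  refine ⟨b₁ * β i - b₂ * β j, fun t => ?_⟩
  have : (fun k => α k + β k * (d k + t * (Pi.single i 1 - Pi.single j 1 : I → ℝ) k)) =
      fun k => α k + β k * d k + β i * t * (Pi.single i 1 : I → ℝ) k +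
        -(β j * t) * (Pi.single j 1 : I → ℝ) k := by
    funext k
    by_cases hi : k = i
    · subst hi
      simp [hij]
      ring
    · by_cases hj : k = j
      · subst hj
        simp [hi]
        ring
      · simp [hi, hj]
  rw [this, h]
  ring

theorem multilinear_single_line (f : Finset I → ℝ) (α β d : I → ℝ) (i : I) (r : ℝ) :
    ∃ b : ℝ, ∀ t : ℝ,
      multilinear f (fun k => α k + β k * (d k + t * (Pi.single i r : I → ℝ) k)) =
        multilinear f (fun k => α k + β k * d k) + b * t := by
  obtain ⟨b, h⟩ := multilinear_one_coordinate f (fun k => α k + β k * d k) i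
  refine ⟨b * β i * r, fun t => ?_⟩
  have : (fun k => α k + β k * (d k + t * (Pi.single i r : I → ℝ) k)) =
      fun k => α k + β k * d k + β i * r * t * (Pi.single i 1 : I → ℝ) k := by
    funext k
    by_cases hi : k = i
    · subst hi
      simp
      ring
    · simp [hi]
  rw [this, h]
  ring

/-- The expected matching value on the free offline nodes, when each `i` is occupied independently
with probability `d i`. -/
theorem exchangeConvex_multilinear_matchValue (D : Finset (B × I)) (ℓ : B × I → ℝ) :
    ExchangeConvex fun d => multilinear (matchValue D ℓ) fun k => 1 + -1 * d k := by
  rintro d hd v (⟨i, r, rfl⟩ | ⟨i, j, hij, rfl⟩)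
  · obtain ⟨b, h⟩ := multilinear_single_line (matchValue D ℓ) (fun _ => 1) (fun _ => -1) d i r
    exact ⟨0, b, le_rfl, fun t => (h t).trans (by ring)⟩
  · obtain ⟨b, h⟩ := multilinear_shift (matchValue D ℓ) (fun _ => 1) (fun _ => -1) d hij
    refine ⟨_, b, ?_, fun t => (h t).trans (by rw [sub_eq_add_neg, ← neg_mul])⟩
    have := multilinear_mono (f := secondDiff (matchValue D ℓ) i j) (g := fun _ => 0)
      (p := fun k => 1 + -1 * d k) (fun k => ⟨by linarith [(hd k).2], by linarith [(hd k).1]⟩)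
      fun F _ => secondDiff_matchValue_nonpos D ℓ hij F
    rw [multilinear_const] at this
    linarith

/-- A dependent rounding of the first batch leaves a set of free nodes that is at least as good for
the second batch as an independent one with the same marginals. -/
theorem IsDependentRounding.multilinear_matchValue_le {B₁ : Type} [Fintype B₁] {z : B₁ × I → ℝ}
    {w : Finset (B₁ × I) → ℝ} (hw : IsDependentRounding z w) (D : Finset (B × I))
    (ℓ : B × I → ℝ) :
    multilinear (matchValue D ℓ) (fun i => 1 - ∑ b, z (b, i)) ≤
      ∑ M, w M * matchValue D ℓ (Finset.univ.filter fun i => ¬Covers M i) := by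
  have h := hw.exchange _ (exchangeConvex_multilinear_matchValue D ℓ)
  have h1 : (fun i => 1 - ∑ b, z (b, i)) = fun i => 1 + -1 * ∑ b, z (b, i) := by
    funext i
    ring
  rw [h1]
  refine h.trans_eq (Finset.sum_congr rfl fun M _ => ?_)
  rw [← multilinear_indicator (matchValue D ℓ)]
  congr 2
  funext i
  by_cases hc : Covers M i <;> simp [coverVec, hc]

end NegativeDependence

/-! ### The bound for vertex weights -/

section VertexBound

open scoped Classical

variable {B I : Type} [Fintype B] [Fintype I]

/-- Subtracting the multilinear matching value from a quadratic energy with weights `a * κ` makes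
the result convex along exchanges: a shift between two nodes changes the energy at second order by
at least the loss that the collision of the two nodes can cause. -/
theorem exchangeConvex_energy_sub_multilinear (D : Finset (B × I)) {a κ : I → ℝ}
    (ha : ∀ i, 0 ≤ a i) (hκ : ∀ i, 0 ≤ κ i ∧ κ i ≤ 1) :
    ExchangeConvex fun d => ∑ k, a k * κ k / 2 * d k ^ 2 -
      multilinear (matchValue D fun e => a e.2) fun k => (1 - κ k) + κ k * d k := by
  have hquad : ∀ d v : I → ℝ, ∀ t : ℝ, ∑ k, a k * κ k / 2 * (d k + t * v k) ^ 2 =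
      ∑ k, a k * κ k / 2 * d k ^ 2 + (∑ k, a k * κ k * d k * v k) * t +
        (∑ k, a k * κ k / 2 * v k ^ 2) * t ^ 2 := by
    intro d v t
    rw [Finset.sum_mul, Finset.sum_mul, ← Finset.sum_add_distrib, ← Finset.sum_add_distrib]
    exact Finset.sum_congr rfl fun k _ => by ring
  have hnn : ∀ k, 0 ≤ a k * κ k := fun k => mul_nonneg (ha k) (hκ k).1
  rintro d hd v (⟨i, r, rfl⟩ | ⟨i, j, hij, rfl⟩)
  · obtain ⟨b, h⟩ :=
      multilinear_single_line (matchValue D fun e => a e.2) (fun k => 1 - κ k) κ d i r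
    refine ⟨∑ k, a k * κ k / 2 * (Pi.single i r : I → ℝ) k ^ 2,
      ∑ k, a k * κ k * d k * (Pi.single i r : I → ℝ) k - b, ?_, fun t => ?_⟩
    rotate_left
    · simp only [h, hquad d (Pi.single i r) t]
      ring
    · exact Finset.sum_nonneg fun k _ => mul_nonneg (by linarith [hnn k]) (sq_nonneg _)
  · obtain ⟨b, h⟩ := multilinear_shift (matchValue D fun e => a e.2) (fun k => 1 - κ k) κ d hij
    refine ⟨∑ k, a k * κ k / 2 * (Pi.single i 1 - Pi.single j 1 : I → ℝ) k ^ 2 + κ i * κ j *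
        multilinear (secondDiff (matchValue D fun e => a e.2) i j) (fun k => 1 - κ k + κ k * d k),
      ∑ k, a k * κ k * d k * (Pi.single i 1 - Pi.single j 1 : I → ℝ) k - b, ?_, fun t => ?_⟩
    rotate_left
    · simp only [h, hquad d (Pi.single i 1 - Pi.single j 1) t]
      ring
    · have hp : ∀ k, 0 ≤ 1 - κ k + κ k * d k ∧ 1 - κ k + κ k * d k ≤ 1 := fun k => by
        constructor
        · nlinarith [(hκ k).1, (hκ k).2, (hd k).1]
        · nlinarith [(hκ k).1, (hd k).2]
      have hDi : -a i ≤ multilinear (secondDiff (matchValue D fun e => a e.2) i j)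
          (fun k => 1 - κ k + κ k * d k) := by
        rw [← multilinear_const (-a i) fun k => 1 - κ k + κ k * d k]
        exact multilinear_mono hp fun F _ =>
          neg_le_secondDiff_matchValue hij (ha i) (Or.inl fun _ => le_rfl) F
      have hDj : -a j ≤ multilinear (secondDiff (matchValue D fun e => a e.2) i j)
          (fun k => 1 - κ k + κ k * d k) := by
        rw [← multilinear_const (-a j) fun k => 1 - κ k + κ k * d k]
        exact multilinear_mono hp fun F _ =>
          neg_le_secondDiff_matchValue hij (ha j) (Or.inr fun _ => le_rfl) F
      have hsum : ∑ k, a k * κ k / 2 * (Pi.single i 1 - Pi.single j 1 : I → ℝ) k ^ 2 =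
          a i * κ i / 2 + a j * κ j / 2 := by
        have : ∀ k, a k * κ k / 2 * (Pi.single i 1 - Pi.single j 1 : I → ℝ) k ^ 2 =
            (if k = i then a k * κ k / 2 else 0) + if k = j then a k * κ k / 2 else 0 := by
          intro k
          by_cases h1 : k = i
          · subst h1
            simp [hij]
          · by_cases h2 : k = j
            · subst h2
              simp [h1]
            · simp [h1, h2]
        rw [Finset.sum_congr rfl fun k _ => this k, Finset.sum_add_distrib]
        simp
      rw [hsum]
      have hκκ : 0 ≤ κ i * κ j := mul_nonneg (hκ i).1 (hκ j).1
      have m1 := mul_le_mul_of_nonneg_left hDi hκκ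
      have m2 := mul_le_mul_of_nonneg_left hDj hκκ
      have n1 : κ i * κ j * a i ≤ a i * κ i := by
        nlinarith [mul_le_mul_of_nonneg_left (hκ j).2 (hnn i)]
      have n2 : κ i * κ j * a j ≤ a j * κ j := by
        nlinarith [mul_le_mul_of_nonneg_left (hκ i).2 (hnn j)]
      linarith

/-- If `i` is free independently with probability `1 - x i`, then the expected weight of covered
offline nodes loses at most `x i * d i / 2`, hence at most an eighth of `x i + d i`, at the node `i`
of fractional degree `d i`. -/
theorem vertex_le_multilinear_matchValue {y : B × I → ℝ} (hy : IsFractionalMatching y)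
    {D : Finset (B × I)} (hD : ∀ e, e ∉ D → y e = 0) {x a : I → ℝ} (hx : ∀ i, 0 ≤ x i)
    (hxy : ∀ i, x i + ∑ b, y (b, i) ≤ 1) (ha : ∀ i, 0 ≤ a i) :
    ∑ i, a i * (∑ b, y (b, i) - (x i + ∑ b, y (b, i)) / 8) ≤
      multilinear (matchValue D fun e => a e.2) fun i => 1 - x i := by
  set d : I → ℝ := fun i => ∑ b, y (b, i) with hd
  have hd0 : ∀ i, 0 ≤ d i := fun i => Finset.sum_nonneg fun b _ => hy.nonneg _
  have hd1 : ∀ i, d i ≤ 1 := hy.offline_le_one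
  -- a node that the rounding of `y` leaves uncovered is occupied with probability `κ i`, which
  -- makes every node free with probability `1 - x i`; if `d i = 1`, then `x i = 0`
  -- and the value `κ i = 0` of the division by zero is the right one
  set κ : I → ℝ := fun i => x i / (1 - d i) with hκdef
  have hκ : ∀ i, 0 ≤ κ i ∧ κ i ≤ 1 := fun i =>
    ⟨div_nonneg (hx i) (sub_nonneg.2 (hd1 i)),
      div_le_one_of_le₀ (by linarith [hxy i]) (sub_nonneg.2 (hd1 i))⟩
  have hκd : ∀ i, κ i * (1 - d i) = x i := fun i => by
    by_cases h : 1 - d i = 0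
    · rw [h, mul_zero]
      linarith [hx i, hxy i]
    · exact div_mul_cancel₀ _ h
  obtain ⟨w, hw⟩ := exists_isDependentRounding y hy
  have hex := hw.exchange _ (exchangeConvex_energy_sub_multilinear D ha hκ)
  have hpt : ∀ M, w M * (∑ k, a k * κ k / 2 * coverVec M k ^ 2 -
      multilinear (matchValue D fun e => a e.2) fun k => (1 - κ k) + κ k * coverVec M k) ≤
      w M * (∑ k, a k * (κ k / 2 - 1) * coverVec M k) := by
    intro M
    by_cases hM : w M = 0
    · simp [hM]
    refine mul_le_mul_of_nonneg_left ?_ (hw.nonneg M)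
    have hcov := coverVec_eq_zero_or_one M
    have hsq : ∀ k, coverVec M k ^ 2 = coverVec M k := fun k => by
      rcases hcov k with h | h <;> rw [h] <;> norm_num
    have hval : ∑ k, a k * coverVec M k ≤
        multilinear (matchValue D fun e => a e.2) fun k => (1 - κ k) + κ k * coverVec M k := by
      rw [← multilinear_const (∑ k, a k * coverVec M k)
        fun k => (1 - κ k) + κ k * coverVec M k]
      refine multilinear_mono (fun k => ?_) fun F hF => ?_
      · rcases hcov k with h | h <;> rw [h] <;> constructor <;> linarith [(hκ k).1, (hκ k).2]
      · have hMD : M ⊆ D := fun e he => by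
          by_contra h
          exact hw.support M hM e he (hD e h)
        refine (sum_mul_coverVec (hw.isMatching M hM) a).trans_le
          (le_matchValue hMD (hw.isMatching M hM) fun e he => hF _ ?_)
        rw [coverVec, if_pos ⟨e.1, he⟩]
        ring
    simp only [hsq]
    have : ∑ k, a k * (κ k / 2 - 1) * coverVec M k =
        ∑ k, a k * κ k / 2 * coverVec M k - ∑ k, a k * coverVec M k := by
      rw [← Finset.sum_sub_distrib]
      exact Finset.sum_congr rfl fun k _ => by ring
    linarith
  have hsum : ∑ M, w M * (∑ k, a k * (κ k / 2 - 1) * coverVec M k) =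
      ∑ k, a k * (κ k / 2 - 1) * d k := by
    simp only [Finset.mul_sum]
    rw [Finset.sum_comm]
    refine Finset.sum_congr rfl fun k _ => ?_
    rw [show d k = ∑ b, y (b, k) from rfl, ← hw.sum_coverVec k, Finset.mul_sum]
    exact Finset.sum_congr rfl fun M _ => by ring
  have h1 := hex.trans ((Finset.sum_le_sum fun M _ => hpt M).trans_eq hsum)
  have hfun : (fun k => (1 - κ k) + κ k * d k) = fun i => 1 - x i := by
    funext k
    rw [← hκd k]
    ring
  change ∑ k, a k * κ k / 2 * d k ^ 2 - multilinear (matchValue D fun e => a e.2)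
    (fun k => (1 - κ k) + κ k * d k) ≤ _ at h1
  rw [hfun] at h1
  have h2 : ∑ i, a i * (d i - (x i + d i) / 8) ≤
      ∑ k, a k * κ k / 2 * d k ^ 2 - ∑ k, a k * (κ k / 2 - 1) * d k := by
    rw [← Finset.sum_sub_distrib]
    refine Finset.sum_le_sum fun k _ => ?_
    have : a k * κ k / 2 * d k ^ 2 - a k * (κ k / 2 - 1) * d k =
        a k * (d k - κ k * (1 - d k) * d k / 2) := by ring
    rw [this, hκd]
    refine mul_le_mul_of_nonneg_left ?_ (ha k)
    have := hxy k
    change x k + d k ≤ 1 at this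
    nlinarith [sq_nonneg (x k - d k), hx k, hd0 k,
      mul_nonneg (add_nonneg (hx k) (hd0 k)) (sub_nonneg.2 this)]
  linarith

end VertexBound

/-! ### The star inequality -/

section Star

open scoped Classical

/-- The edge-uniform factor, the positive root of `c ^ 2 + 4 * c = 4`. -/
noncomputable def edgeFactor : ℝ := 2 * Real.sqrt 2 - 2

theorem edgeFactor_sq : edgeFactor ^ 2 = 4 - 4 * edgeFactor := by
  have := Real.sq_sqrt (show (0 : ℝ) ≤ 2 by norm_num)
  rw [edgeFactor]
  linarith

theorem edgeFactor_bounds : 82 / 100 < edgeFactor ∧ edgeFactor < 83 / 100 := by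
  have h := edgeFactor_sq
  have h0 : 0 ≤ edgeFactor := by
    have : (1 : ℝ) ≤ Real.sqrt 2 := Real.one_le_sqrt.2 (by norm_num)
    rw [edgeFactor]
    linarith
  constructor <;> nlinarith

variable {I : Type}

theorem star_inequality_three {a b d : ℝ} (ha : 0 ≤ a) (hb : 0 ≤ b) (hd : 0 ≤ d)
    (hs : a + b + d ≤ 1) :
    edgeFactor ^ 3 * ((1 - a) * (1 - b) * (1 - d)) ≤ 1 - edgeFactor * (a + b + d) := by
  obtain ⟨h1, h2⟩ := edgeFactor_bounds
  have hsq := edgeFactor_sq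
  set c := edgeFactor
  -- arithmetic and geometric means of the three factors
  have hamgm : (1 - a) * (1 - b) * (1 - d) ≤ (1 - (a + b + d) / 3) ^ 3 := by
    have hx : 0 ≤ 1 - a := by linarith
    have hy : 0 ≤ 1 - b := by linarith
    have hz : 0 ≤ 1 - d := by linarith
    nlinarith [mul_nonneg hx (sq_nonneg (b - d)), mul_nonneg hy (sq_nonneg (a - d)),
      mul_nonneg hz (sq_nonneg (a - b)), mul_nonneg (add_nonneg (add_nonneg hx hy) hz)
      (add_nonneg (add_nonneg (sq_nonneg (b - d)) (sq_nonneg (a - d))) (sq_nonneg (a - b)))]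
  have hc3 : c ^ 3 = 20 * c - 16 := by
    have : c ^ 3 = c * c ^ 2 := by ring
    rw [this, hsq]
    nlinarith
  have hc3' : 0 ≤ c ^ 3 := by positivity
  refine (mul_le_mul_of_nonneg_left hamgm hc3').trans ?_
  set s := a + b + d
  have hs0 : 0 ≤ s := by positivity
  -- a convex function of `s` lies below its chord over `[0, 1]`
  have hchord : (1 - s / 3) ^ 3 ≤ 1 - 19 / 27 * s := by
    nlinarith [mul_nonneg hs0 (sub_nonneg.2 hs), mul_nonneg (mul_nonneg hs0 hs0) (sub_nonneg.2 hs)]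
  refine (mul_le_mul_of_nonneg_left hchord hc3').trans ?_
  rw [hc3]
  nlinarith

/-- The availabilities `1 - c * (1 - y i)` of the neighbours of an online node suffice to serve
every set of neighbours: the node finds none of them free with probability at most `1 - c` times
their total value. The bound is tight for two neighbours of value `1 / 2`, which determines `c`. -/
theorem star_inequality : ∀ (n : ℕ) (S : Finset I) (y : I → ℝ), S.card = n →
    (∀ i ∈ S, 0 ≤ y i) → ∑ i ∈ S, y i ≤ 1 →
    ∏ i ∈ S, (edgeFactor * (1 - y i)) ≤ 1 - edgeFactor * ∑ i ∈ S, y i := by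
  obtain ⟨h1, h2⟩ := edgeFactor_bounds
  have hsq := edgeFactor_sq
  intro n
  induction n with
  | zero =>
    intro S y hS _ _
    rw [Finset.card_eq_zero.1 hS]
    simp
  | succ n ih =>
    intro S y hS hy hsum
    rcases n with _ | _ | _ | n
    · obtain ⟨a, rfl⟩ := Finset.card_eq_one.1 hS
      simp only [Finset.prod_singleton, Finset.sum_singleton]
      linarith
    · obtain ⟨a, b, hab, rfl⟩ := Finset.card_eq_two.1 hS
      rw [Finset.prod_pair hab, Finset.sum_pair hab] at *
      have ha := hy a (by simp)
      have hb := hy b (by simp)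
      have h3 : (1 - y a) * (1 - y b) ≤ 1 - 3 / 4 * (y a + y b) := by
        nlinarith [sq_nonneg (y a - y b), mul_nonneg (add_nonneg ha hb) (sub_nonneg.2 hsum)]
      have : edgeFactor * (1 - y a) * (edgeFactor * (1 - y b)) =
          edgeFactor ^ 2 * ((1 - y a) * (1 - y b)) := by ring
      rw [this]
      refine (mul_le_mul_of_nonneg_left h3 (sq_nonneg _)).trans ?_
      rw [hsq]
      nlinarith
    · obtain ⟨a, b, d, hab, had, hbd, rfl⟩ := Finset.card_eq_three.1 hS
      have ha := hy a (by simp)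
      have hb := hy b (by simp)
      have hd := hy d (by simp)
      rw [Finset.sum_insert (by simp [hab, had]), Finset.sum_pair hbd] at *
      rw [Finset.prod_insert (by simp [hab, had]), Finset.prod_pair hbd]
      have := star_inequality_three ha hb hd (by linarith)
      rw [add_assoc] at this
      refine le_trans (le_of_eq (by ring)) this
    · -- among four values two have sum at most `1 / 2`; they can be merged into one
      obtain ⟨i, hi, j, hj, hij, hle⟩ : ∃ i ∈ S, ∃ j ∈ S, i ≠ j ∧ y i + y j ≤ 1 / 2 := by
        obtain ⟨T, hTS, hT⟩ := Finset.exists_subset_card_eq (s := S) (n := 4) (by omega)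
        obtain ⟨a, b, d, e, hab, had, hae, hbd, hbe, hde, rfl⟩ := Finset.card_eq_four.1 hT
        have hT1 := (Finset.sum_le_sum_of_subset_of_nonneg hTS fun k hk _ => hy k hk).trans hsum
        rw [Finset.sum_insert (by simp [hab, had, hae]), Finset.sum_insert (by simp [hbd, hbe]),
          Finset.sum_pair hde] at hT1
        by_cases h : y a + y b ≤ 1 / 2
        · exact ⟨a, hTS (by simp), b, hTS (by simp), hab, h⟩
        · exact ⟨d, hTS (by simp), e, hTS (by simp), hde, by linarith⟩
      have hjS : j ∈ S.erase i := Finset.mem_erase.2 ⟨hij.symm, hj⟩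
      have hrest : ∀ k ∈ (S.erase i).erase j, Function.update y j (y i + y j) k = y k := by
        intro k hk
        rw [Function.update_of_ne (Finset.ne_of_mem_erase hk)]
      have hS' : ∑ k ∈ S.erase i, Function.update y j (y i + y j) k = ∑ k ∈ S, y k := by
        rw [← Finset.add_sum_erase _ _ hjS, Function.update_self, Finset.sum_congr rfl hrest,
          ← Finset.add_sum_erase S _ hi, ← Finset.add_sum_erase _ y hjS, add_assoc]
      have := ih (S.erase i) (Function.update y j (y i + y j))
        (by rw [Finset.card_erase_of_mem hi, hS]; omega)
        (fun k hk => by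
          by_cases hkj : k = j
          · subst hkj
            rw [Function.update_self]
            exact add_nonneg (hy i hi) (hy k hj)
          · rw [Function.update_of_ne hkj]
            exact hy k (Finset.mem_of_mem_erase hk))
        (by rw [hS']; exact hsum)
      rw [hS', ← Finset.mul_prod_erase _ _ hjS, Function.update_self,
        Finset.prod_congr rfl fun k hk => by rw [hrest k hk]] at this
      refine le_trans ?_ this
      rw [← Finset.mul_prod_erase S _ hi, ← Finset.mul_prod_erase _ (fun k => _) hjS, ← mul_assoc]
      refine mul_le_mul_of_nonneg_right ?_ (Finset.prod_nonneg fun k hk => ?_)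
      · have hyi := hy i hi
        have hyj := hy j hj
        have : edgeFactor * (y i * y j) ≤ (1 - edgeFactor) * (1 - (y i + y j)) := by
          nlinarith [sq_nonneg (y i - y j), mul_nonneg hyi hyj]
        nlinarith
      · have hkS := Finset.mem_of_mem_erase (Finset.mem_of_mem_erase hk)
        have := (Finset.single_le_sum (f := y) (fun k hk => hy k hk) hkS).trans hsum
        exact mul_nonneg (by linarith) (by linarith)

end Star

/-! ### The bound for edge weights -/

section EdgeBound

open scoped Classical

section MaxWeight

variable {I : Type}

/-- The largest weight on the set `G`, or zero if that is larger. -/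
noncomputable def maxWeight (μ : I → ℝ) (G : Finset I) : ℝ :=
  (insert 0 (G.image μ)).max' (Finset.insert_nonempty _ _)

theorem maxWeight_nonneg (μ : I → ℝ) (G : Finset I) : 0 ≤ maxWeight μ G :=
  Finset.le_max' _ _ (Finset.mem_insert_self _ _)

theorem le_maxWeight (μ : I → ℝ) {G : Finset I} {i : I} (hi : i ∈ G) : μ i ≤ maxWeight μ G :=
  Finset.le_max' _ _ (Finset.mem_insert_of_mem (Finset.mem_image_of_mem μ hi))

theorem maxWeight_eq (μ : I → ℝ) (G : Finset I) :
    maxWeight μ G = 0 ∨ ∃ i ∈ G, maxWeight μ G = μ i := by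
  have := Finset.max'_mem (insert 0 (G.image μ)) (Finset.insert_nonempty _ _)
  rw [Finset.mem_insert, Finset.mem_image] at this
  rcases this with h | ⟨i, hi, h⟩
  · exact Or.inl h
  · exact Or.inr ⟨i, hi, h.symm⟩

variable [Fintype I]

/-- The weighted form of the star inequality, by peeling off the smallest positive weight. -/
theorem star_le_multilinear_maxWeight {N : Finset I} {y p : I → ℝ} (hy : ∀ i ∈ N, 0 ≤ y i)
    (hsum : ∑ i ∈ N, y i ≤ 1) (hp : ∀ i, 0 ≤ p i ∧ p i ≤ 1)
    (hpy : ∀ i ∈ N, 1 - edgeFactor * (1 - y i) ≤ p i) (μ : I → ℝ) :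
    edgeFactor * ∑ i ∈ N, y i * μ i ≤ multilinear (fun F => maxWeight μ (F ∩ N)) p := by
  have hc : 0 ≤ edgeFactor := by linarith [edgeFactor_bounds.1]
  induction hn : (N.filter fun i => 0 < μ i).card using Nat.strong_induction_on generalizing μ with
  | _ n ih =>
    set S := N.filter fun i => 0 < μ i with hS
    have hSN : S ⊆ N := Finset.filter_subset _ _
    rcases S.eq_empty_or_nonempty with hemp | hne
    · have hμ : ∀ i ∈ N, μ i ≤ 0 := fun i hi => by
        by_contra! h
        exact Finset.notMem_empty i (hemp ▸ Finset.mem_filter.2 ⟨hi, h⟩)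
      have h1 : ∑ i ∈ N, y i * μ i ≤ 0 := Finset.sum_nonpos fun i hi =>
        mul_nonpos_of_nonneg_of_nonpos (hy i hi) (hμ i hi)
      refine (mul_nonpos_of_nonneg_of_nonpos hc h1).trans ?_
      rw [← multilinear_const 0 p]
      exact multilinear_mono hp fun F _ => maxWeight_nonneg _ _
    · obtain ⟨i₀, hi₀, hmin⟩ := S.exists_min_image μ hne
      have hm : 0 < μ i₀ := (Finset.mem_filter.1 hi₀).2
      set μ' : I → ℝ := fun i => if i ∈ S then μ i - μ i₀ else μ i with hμ'
      have hlt : (N.filter fun i => 0 < μ' i).card < n := by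
        rw [← hn]
        refine Finset.card_lt_card (Finset.ssubset_iff_of_subset ?_ |>.2 ⟨i₀, hi₀, ?_⟩)
        · intro i hi
          rw [Finset.mem_filter] at hi
          by_contra hiS
          exact hiS (Finset.mem_filter.2 ⟨hi.1, by simpa [hμ', hiS] using hi.2⟩)
        · simp [hμ', hi₀]
      have hIH := ih _ hlt μ' rfl
      have hpt : ∀ F : Finset I, maxWeight μ' (F ∩ N) +
          μ i₀ * (1 - if F ∩ S = ∅ then 1 else 0) ≤ maxWeight μ (F ∩ N) := by
        intro F
        have hle : ∀ i, μ' i ≤ μ i := fun i => by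
          simp only [hμ']
          split_ifs <;> linarith
        by_cases hFS : F ∩ S = ∅
        · rw [if_pos hFS, sub_self, mul_zero, add_zero]
          rcases maxWeight_eq μ' (F ∩ N) with h | ⟨i, hi, h⟩
          · rw [h]
            exact maxWeight_nonneg _ _
          · rw [h]
            exact (hle i).trans (le_maxWeight μ hi)
        · rw [if_neg hFS, sub_zero, mul_one]
          obtain ⟨k, hk⟩ := Finset.nonempty_iff_ne_empty.2 hFS
          rw [Finset.mem_inter] at hk
          have hkm : μ i₀ ≤ maxWeight μ (F ∩ N) :=
            (hmin k hk.2).trans (le_maxWeight μ (Finset.mem_inter.2 ⟨hk.1, hSN hk.2⟩))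
          rcases maxWeight_eq μ' (F ∩ N) with h | ⟨i, hi, h⟩
          · rw [h, zero_add]
            exact hkm
          · by_cases hiS : i ∈ S
            · have : μ' i = μ i - μ i₀ := by simp [hμ', hiS]
              rw [h, this, sub_add_cancel]
              exact le_maxWeight μ hi
            · have h1 : μ' i = μ i := by simp [hμ', hiS]
              have h2 : μ i ≤ 0 := by
                by_contra! h0
                exact hiS (Finset.mem_filter.2 ⟨(Finset.mem_inter.1 hi).2, h0⟩)
              rw [h, h1]
              linarith
      have hmono := multilinear_mono hp fun F _ => hpt F
      rw [multilinear_add, multilinear_const_mul, multilinear_sub, multilinear_const,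
        multilinear_disjoint] at hmono
      have hprod : ∏ i ∈ S, (1 - p i) ≤ 1 - edgeFactor * ∑ i ∈ S, y i :=
        (Finset.prod_le_prod (fun i _ => sub_nonneg.2 (hp i).2) fun i hi => by
          linarith [hpy i (hSN hi)]).trans
          (star_inequality _ S y rfl (fun i hi => hy i (hSN hi))
            ((Finset.sum_le_sum_of_subset_of_nonneg hSN fun i hi _ => hy i hi).trans hsum))
      have hsplit : ∑ i ∈ N, y i * μ i = ∑ i ∈ N, y i * μ' i + μ i₀ * ∑ i ∈ S, y i := by
        have h1 : ∑ i ∈ S, y i = ∑ i ∈ N, if i ∈ S then y i else 0 := by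
          rw [← Finset.sum_filter]
          congr 1
          ext i
          simp only [Finset.mem_filter]
          exact ⟨fun h => ⟨hSN h, h⟩, fun h => h.2⟩
        rw [h1, Finset.mul_sum, ← Finset.sum_add_distrib]
        refine Finset.sum_congr rfl fun i _ => ?_
        simp only [hμ']
        split_ifs <;> ring
      rw [hsplit]
      nlinarith

end MaxWeight

variable {B I : Type} [Fintype B] [Fintype I]

/-- A nonempty bipartite graph has a circulation, or an online node all of whose neighbours, except
possibly one, have no other neighbour. Away from the edges whose offline node has degree one, the
offline nodes are no leaves, so a leaf is such an online node. -/
theorem exists_circulation_or_peelable {D : Finset (B × I)} (hD : D.Nonempty) :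
    (∃ v : B × I → ℝ, v ≠ 0 ∧ (∀ e, e ∉ D → v e = 0) ∧ (∀ b, ∑ i, v (b, i) = 0) ∧
        ∀ i, ∑ b, v (b, i) = 0) ∨
      ∃ b i₀, (b, i₀) ∈ D ∧
        ∀ i, i ≠ i₀ → (b, i) ∈ D → ∀ b', (b', i) ∈ D → b' = b := by
  set L : Finset (B × I) := D.filter fun e => ∃ b', b' ≠ e.1 ∧ (b', e.2) ∈ D with hL
  have hmem : ∀ e, e ∈ L ↔ e ∈ D ∧ ∃ b', b' ≠ e.1 ∧ (b', e.2) ∈ D := by simp [hL]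
  rcases L.eq_empty_or_nonempty with hemp | hne
  · obtain ⟨⟨b, i₀⟩, h⟩ := hD
    refine Or.inr ⟨b, i₀, h, fun i _ hi b' hb' => ?_⟩
    by_contra hb
    exact Finset.notMem_empty (b, i) (hemp ▸ (hmem _).2 ⟨hi, b', hb, hb'⟩)
  · rcases exists_circulation_or_flow_between_leaves (V := B ⊕ I) (fun e : B × I => Sum.inl e.1)
      (fun e => Sum.inr e.2) (fun e => Sum.inl_ne_inr) L hne with
      ⟨v, hv0, hvL, hv⟩ | ⟨u, -, -, ⟨⟨b, i₀⟩, ⟨he, heu⟩, huniq⟩, -, -⟩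
    · rw [netFlow_bipartite] at hv
      exact Or.inl ⟨v, hv0, fun e he => hvL e fun h => he ((hmem e).1 h).1,
        fun b => congrFun hv (Sum.inl b), fun i => neg_eq_zero.1 (congrFun hv (Sum.inr i))⟩
    · obtain ⟨heD, b', hb', hb'D⟩ := (hmem _).1 he
      rcases heu with rfl | rfl
      · refine Or.inr ⟨b, i₀, heD, fun i hi hbi c hc => ?_⟩
        by_contra hcb
        exact hi (Prod.ext_iff.1 (huniq (b, i) ⟨(hmem _).2 ⟨hbi, c, hcb, hc⟩, Or.inl rfl⟩)).2
      · exact absurd (Prod.ext_iff.1 (huniq (b', i₀)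
          ⟨(hmem _).2 ⟨hb'D, b, hb'.symm, heD⟩, Or.inr rfl⟩)).1 hb'

theorem matchValue_nonneg (D : Finset (B × I)) (ℓ : B × I → ℝ) (F : Finset I) :
    0 ≤ matchValue D ℓ F := by
  simpa using le_matchValue (ℓ := ℓ) (F := F) (Finset.empty_subset D) isMatching_empty (by simp)

/-- Serving the online node `b` by `i` on top of a matching of the other online nodes. -/
theorem add_matchValue_le {D : Finset (B × I)} (ℓ : B × I → ℝ) {b : B} {i : I}
    (hbi : (b, i) ∈ D) {F F' : Finset I} (hF : F' ⊆ F) (hiF : i ∈ F)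
    (hfree : ∀ b', b' ≠ b → (b', i) ∈ D → i ∉ F') :
    ℓ (b, i) + matchValue (D.filter fun e => e.1 ≠ b) ℓ F' ≤ matchValue D ℓ F := by
  obtain ⟨M, hMD, hM, hMF, h⟩ := exists_matchValue_eq (D.filter fun e => e.1 ≠ b) ℓ F'
  have hMD' : ∀ e ∈ M, e ∈ D ∧ e.1 ≠ b := fun e he => Finset.mem_filter.1 (hMD he)
  have hMi : ∀ e ∈ M, e.2 ≠ i := by
    rintro ⟨b', i'⟩ he rfl
    exact hfree b' (hMD' _ he).2 (hMD' _ he).1 (hMF _ he)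
  rw [h, ← Finset.sum_insert fun hb => (hMD' _ hb).2 rfl]
  refine le_matchValue (Finset.insert_subset hbi fun e he => (hMD' e he).1) ?_ ?_
  · intro e he f hf hshare
    rw [Finset.mem_insert] at he hf
    rcases he with rfl | he <;> rcases hf with rfl | hf
    · rfl
    · rcases hshare with h | h
      · exact absurd h.symm (hMD' f hf).2
      · exact absurd h.symm (hMi f hf)
    · rcases hshare with h | h
      · exact absurd h (hMD' e he).2
      · exact absurd h (hMi e he)
    · exact hM e he f hf hshare
  · intro e he
    rw [Finset.mem_insert] at he
    rcases he with rfl | he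
    · exact hiF
    · exact hF (hMF e he)

/-- Removing an online node `b` with at most one neighbour `i₀` of degree above one: `b` gains its
share of the weight, at the price of lowering the availability of `i₀` by its share in `i₀`. -/
theorem peel_le_multilinear_matchValue {D : Finset (B × I)} (ℓ : B × I → ℝ) {b : B} {i₀ : I}
    (hb : (b, i₀) ∈ D) (hpeel : ∀ i, i ≠ i₀ → (b, i) ∈ D → ∀ b', (b', i) ∈ D → b' = b)
    {y p : I → ℝ} (hy : ∀ i, 0 ≤ y i) (hyD : ∀ i, (b, i) ∉ D → y i = 0) (hsum : ∑ i, y i ≤ 1)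
    (hp : ∀ i, 0 ≤ p i ∧ p i ≤ 1) (hpy : ∀ i, 1 - edgeFactor * (1 - y i) ≤ p i) :
    edgeFactor * ∑ i, y i * ℓ (b, i) +
        multilinear (matchValue (D.filter fun e => e.1 ≠ b) ℓ)
          (Function.update p i₀ (p i₀ - edgeFactor * y i₀)) ≤
      multilinear (matchValue D ℓ) p := by
  set f := matchValue (D.filter fun e => e.1 ≠ b) ℓ with hf
  set N : Finset I := Finset.univ.filter fun i => (b, i) ∈ D with hN
  have hmemN : ∀ i, i ∈ N ↔ (b, i) ∈ D := by simp [hN]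
  have hi₀N : i₀ ∈ N := (hmemN _).2 hb
  -- the other neighbours of `b` do not matter for the remaining graph
  have hfcongr : ∀ F F' : Finset I, (∀ i, (i ∉ N ∨ i = i₀) → i ∈ F → i ∈ F') → f F ≤ f F' := by
    intro F F' h
    refine matchValue_mono subset_rfl fun e he heF => h e.2 ?_ heF
    rw [Finset.mem_filter] at he
    by_contra! h'
    exact he.2 (hpeel e.2 h'.2 ((hmemN _).1 h'.1) e.1 he.1)
  -- the loss in the remaining graph if `i₀` is used
  set δ : Finset I → ℝ := fun F => f (insert i₀ F) - f (F.erase i₀) with hδ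
  have hδN : ∀ F, δ (F \ N) = δ F := by
    intro F
    have h1 : f (insert i₀ (F \ N)) = f (insert i₀ F) := by
      refine le_antisymm (hfcongr _ _ fun i _ hi => ?_) (hfcongr _ _ fun i h hi => ?_)
      · simp only [Finset.mem_insert, Finset.mem_sdiff] at hi ⊢
        tauto
      · simp only [Finset.mem_insert, Finset.mem_sdiff] at hi ⊢
        tauto
    have h2 : f ((F \ N).erase i₀) = f (F.erase i₀) := by
      refine le_antisymm (hfcongr _ _ fun i _ hi => ?_) (hfcongr _ _ fun i h hi => ?_)
      · simp only [Finset.mem_erase, Finset.mem_sdiff] at hi ⊢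
        tauto
      · simp only [Finset.mem_erase, Finset.mem_sdiff] at hi ⊢
        tauto
    simp only [hδ, h1, h2]
  set μ : Finset I → I → ℝ := fun R i => if i = i₀ then ℓ (b, i₀) - δ R else ℓ (b, i) with hμ
  have hpt : ∀ F : Finset I, f F + maxWeight (μ (F \ N)) (F ∩ N) ≤ matchValue D ℓ F := by
    intro F
    rcases maxWeight_eq (μ (F \ N)) (F ∩ N) with h | ⟨i, hi, h⟩
    · rw [h, add_zero]
      exact matchValue_mono (Finset.filter_subset _ _) fun _ _ h => h
    · rw [Finset.mem_inter] at hi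
      rw [h]
      by_cases hii : i = i₀
      · subst hii
        have := add_matchValue_le ℓ hb (Finset.erase_subset i F) hi.1 fun _ _ _ => by simp
        simp only [hμ, if_true, hδN]
        simp only [hδ, Finset.insert_eq_of_mem hi.1]
        linarith
      · have := add_matchValue_le ℓ ((hmemN i).1 hi.2) (subset_refl F) hi.1 fun b' hb' hb'i =>
          absurd (hpeel i hii ((hmemN i).1 hi.2) b' hb'i) hb'
        simp only [hμ, if_neg hii]
        linarith
  have hmono := multilinear_mono hp fun F _ => hpt F
  rw [multilinear_add, multilinear_eq_sum_condition N (fun R G => maxWeight (μ R) G)] at hmono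
  have hcond : ∑ R : Finset I, multilinear (fun F => if F \ N = R then 1 else 0) p *
      (edgeFactor * ∑ i ∈ N, y i * μ R i) ≤
      ∑ R : Finset I, multilinear (fun F => if F \ N = R then 1 else 0) p *
        multilinear (fun F => maxWeight (μ R) (F ∩ N)) p := by
    refine Finset.sum_le_sum fun R _ => mul_le_mul_of_nonneg_left ?_ ?_
    · exact star_le_multilinear_maxWeight (fun i _ => hy i)
        ((Finset.sum_le_sum_of_subset_of_nonneg (Finset.subset_univ N)
          fun i _ _ => hy i).trans hsum)
        hp (fun i _ => hpy i) (μ R)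
    · exact (multilinear_const 0 p).symm.le.trans
        (multilinear_mono hp fun F _ => by split_ifs <;> norm_num)
  have hback := multilinear_eq_sum_condition N (fun R _ => edgeFactor * ∑ i ∈ N, y i * μ R i) p
  simp only [multilinear_const] at hback
  rw [← hback] at hcond
  have hval : ∀ F, edgeFactor * ∑ i ∈ N, y i * μ (F \ N) i =
      edgeFactor * ∑ i, y i * ℓ (b, i) - edgeFactor * y i₀ * δ F := by
    intro F
    have h1 : ∑ i, y i * ℓ (b, i) = ∑ i ∈ N, y i * ℓ (b, i) := by
      refine (Finset.sum_subset (Finset.subset_univ N) fun i _ hi => ?_).symm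
      rw [hyD i fun h => hi ((hmemN i).2 h), zero_mul]
    rw [h1, ← Finset.add_sum_erase N _ hi₀N, ← Finset.add_sum_erase N _ hi₀N]
    have h2 : ∑ i ∈ N.erase i₀, y i * μ (F \ N) i = ∑ i ∈ N.erase i₀, y i * ℓ (b, i) :=
      Finset.sum_congr rfl fun i hi => by
        simp only [hμ, if_neg (Finset.ne_of_mem_erase hi)]
    rw [h2]
    simp only [hμ, if_true, hδN]
    ring
  simp only [hval] at hcond
  rw [multilinear_sub, multilinear_const, multilinear_const_mul] at hcond
  have hδval : multilinear δ p =
      multilinear (fun F => f (insert i₀ F)) p - multilinear (fun F => f (F.erase i₀)) p :=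
    multilinear_sub _ _ _
  have hupd : multilinear f (Function.update p i₀ (p i₀ - edgeFactor * y i₀)) =
      multilinear f p - edgeFactor * y i₀ * multilinear δ p := by
    have hoff : ∀ k, k ≠ i₀ → Function.update p i₀ (p i₀ - edgeFactor * y i₀) k = p k :=
      fun k hk => Function.update_of_ne hk _ _
    rw [multilinear_split f _ i₀, multilinear_split f p i₀,
      multilinear_congr_of_indep (f := fun F => f (insert i₀ F)) (fun F => ?_) hoff,
      multilinear_congr_of_indep (f := fun F => f (F.erase i₀)) (fun F => ?_) hoff,
      Function.update_self, hδval]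
    · ring
    · rw [Finset.erase_idem, Finset.erase_insert_eq_erase]
    · congr 1
      ext k
      by_cases hk : k = i₀ <;> simp [hk]
  rw [hupd]
  linarith

/-- If each offline node is free independently with probability at least `1 - c` plus `c` times its
value in the second batch, then the expected weight of an optimal second matching is at least `c`
times the fractional weight. Circulations reduce the support to a forest, from which online nodes
are peeled off one by one. -/
theorem edge_le_multilinear_matchValue (ℓ : B × I → ℝ) (D : Finset (B × I)) :
    ∀ (y : B × I → ℝ) (p : I → ℝ), (∀ e, 0 ≤ y e) → (∀ e, e ∉ D → y e = 0) →
      (∀ b, ∑ i, y (b, i) ≤ 1) → (∀ i, 1 - edgeFactor * (1 - ∑ b, y (b, i)) ≤ p i) →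
      (∀ i, p i ≤ 1) →
      edgeFactor * ∑ e, ℓ e * y e ≤ multilinear (matchValue D ℓ) p := by
  obtain ⟨hc1, hc2⟩ := edgeFactor_bounds
  induction D using Finset.strongInduction with
  | H D ih =>
    intro y p hy hyD hyB hpy hp1
    have hdeg : ∀ b i, y (b, i) ≤ ∑ b, y (b, i) := fun b i =>
      Finset.single_le_sum (f := fun b => y (b, i)) (fun b _ => hy _) (Finset.mem_univ b)
    have hdeg0 : ∀ i, 0 ≤ ∑ b, y (b, i) := fun i => Finset.sum_nonneg fun b _ => hy _
    have hp : ∀ i, 0 ≤ p i ∧ p i ≤ 1 := fun i => ⟨by nlinarith [hpy i, hdeg0 i], hp1 i⟩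
    have herase : ∀ y' : B × I → ℝ, (∀ e, 0 ≤ y' e) → (∀ e, e ∉ D → y' e = 0) →
        (∀ b, ∑ i, y' (b, i) ≤ 1) → (∀ i, 1 - edgeFactor * (1 - ∑ b, y' (b, i)) ≤ p i) →
        (∃ e ∈ D, y' e = 0) →
        edgeFactor * ∑ e, ℓ e * y' e ≤ multilinear (matchValue D ℓ) p := by
      rintro y' hy' hy'D hy'B hpy' ⟨e, he, he0⟩
      refine (ih (D.erase e) (Finset.erase_ssubset he) y' p hy' (fun f hf => ?_) hy'B hpy'
        hp1).trans (multilinear_mono hp fun F _ =>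
          matchValue_mono (Finset.erase_subset _ _) fun _ _ h => h)
      by_cases hfe : f = e
      · rw [hfe, he0]
      · exact hy'D f fun h => hf (Finset.mem_erase.2 ⟨hfe, h⟩)
    by_cases hzero : ∃ e ∈ D, y e = 0
    · exact herase y hy hyD hyB hpy hzero
    rcases D.eq_empty_or_nonempty with rfl | hne
    · have : ∑ e, ℓ e * y e = 0 :=
        Finset.sum_eq_zero fun e _ => by rw [hyD e (Finset.notMem_empty e), mul_zero]
      rw [this, mul_zero, ← multilinear_const 0 p]
      exact multilinear_mono hp fun F _ => matchValue_nonneg _ _ _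
    rcases exists_circulation_or_peelable hne with ⟨v, hv0, hvD, hvB, hvI⟩ | ⟨b, i₀, hb, hpeel⟩
    · -- moving along the circulation in the direction of larger weight
      obtain ⟨v, hv0, hvD, hvB, hvI, hvℓ⟩ : ∃ v : B × I → ℝ, v ≠ 0 ∧ (∀ e, e ∉ D → v e = 0) ∧
          (∀ b, ∑ i, v (b, i) = 0) ∧ (∀ i, ∑ b, v (b, i) = 0) ∧ 0 ≤ ∑ e, ℓ e * v e := by
        rcases le_total 0 (∑ e, ℓ e * v e) with h | h
        · exact ⟨v, hv0, hvD, hvB, hvI, h⟩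
        · exact ⟨-v, neg_ne_zero.2 hv0, fun e he => by simp [hvD e he], fun b => by simp [hvB],
            fun i => by simp [hvI], by simpa using h⟩
      have hneg : ∃ e, v e < 0 := by
        obtain ⟨e | b | i, hk⟩ := exists_slackRate_neg hv0
        · exact ⟨e, hk⟩
        · simp [slackRate, hvB] at hk
        · simp [slackRate, hvI] at hk
      obtain ⟨t, ht, hnn, e, he, he0⟩ := exists_step_to_tight y v hy
        (fun e he => hvD e fun h => hzero ⟨e, h, he⟩) hneg
      have := herase (fun e => y e + t * v e) hnn
        (fun e he => by rw [hyD e he, hvD e he, mul_zero, add_zero])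
        (fun b => by
          rw [Finset.sum_add_distrib, ← Finset.mul_sum, hvB, mul_zero, add_zero]
          exact hyB b)
        (fun i => by
          rw [Finset.sum_add_distrib, ← Finset.mul_sum, hvI, mul_zero, add_zero]
          exact hpy i)
        ⟨e, by_contra fun h => he (hyD e h), he0⟩
      refine le_trans (mul_le_mul_of_nonneg_left ?_ (by linarith)) this
      have hexp : ∑ e, ℓ e * (y e + t * v e) = ∑ e, ℓ e * y e + t * ∑ e, ℓ e * v e := by
        rw [Finset.mul_sum, ← Finset.sum_add_distrib]
        exact Finset.sum_congr rfl fun e _ => by ring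
      rw [hexp]
      linarith [mul_nonneg ht.le hvℓ]
    · have hpeelD : D.filter (fun e => e.1 ≠ b) ⊂ D :=
        Finset.filter_ssubset.2 ⟨(b, i₀), hb, by simp⟩
      set y' : B × I → ℝ := fun e => if e.1 = b then 0 else y e with hy'
      have hdeg' : ∀ i, ∑ b', y' (b', i) = ∑ b', y (b', i) - y (b, i) := by
        intro i
        rw [← Finset.add_sum_erase _ _ (Finset.mem_univ b),
          ← Finset.add_sum_erase _ (fun b' => y (b', i)) (Finset.mem_univ b)]
        have : ∑ b' ∈ Finset.univ.erase b, y' (b', i) = ∑ b' ∈ Finset.univ.erase b, y (b', i) :=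
          Finset.sum_congr rfl fun b' hb' => by simp [hy', Finset.ne_of_mem_erase hb']
        rw [this]
        simp [hy']
      have hIH := ih _ hpeelD y' (Function.update p i₀ (p i₀ - edgeFactor * y (b, i₀)))
        (fun e => by
          simp only [hy']
          split_ifs
          · exact le_rfl
          · exact hy e)
        (fun e he => by
          simp only [hy']
          split_ifs with h
          · rfl
          · exact hyD e fun h' => he (Finset.mem_filter.2 ⟨h', h⟩))
        (fun b' => by
          by_cases h : b' = b
          · simp [hy', h]
          · simpa [hy', h] using hyB b')
        (fun i => by
          rw [hdeg']
          by_cases hi : i = i₀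
          · subst hi
            rw [Function.update_self]
            linarith [hpy i]
          · rw [Function.update_of_ne hi]
            nlinarith [hpy i, hy (b, i)])
        (fun i => by
          by_cases hi : i = i₀
          · subst hi
            rw [Function.update_self]
            nlinarith [hp1 i, hy (b, i)]
          · rw [Function.update_of_ne hi]
            exact hp1 i)
      have hstep := peel_le_multilinear_matchValue ℓ hb hpeel (y := fun i => y (b, i)) (p := p)
        (fun i => hy _) (fun i hi => hyD _ hi) (hyB b) hp
        (fun i => by nlinarith [hpy i, hdeg b i])
      have hsplit : ∑ e, ℓ e * y e = ∑ i, y (b, i) * ℓ (b, i) + ∑ e, ℓ e * y' e := by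
        rw [Fintype.sum_prod_type, Fintype.sum_prod_type,
          ← Finset.add_sum_erase _ _ (Finset.mem_univ b),
          ← Finset.add_sum_erase _ (fun b' => ∑ i, ℓ (b', i) * y' (b', i)) (Finset.mem_univ b)]
        have h1 : ∑ b' ∈ Finset.univ.erase b, ∑ i, ℓ (b', i) * y' (b', i) =
            ∑ b' ∈ Finset.univ.erase b, ∑ i, ℓ (b', i) * y (b', i) :=
          Finset.sum_congr rfl fun b' hb' => by simp [hy', Finset.ne_of_mem_erase hb']
        rw [h1]
        simp [hy', mul_comm]
      rw [hsplit, mul_add]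
      linarith

end EdgeBound

/-! ### Minimax duality -/

section Duality

open scoped Classical

/-- Minimax duality for finitely many pure strategies `s` with payoff vectors `A s`: if for all
nonnegative weights some pure strategy reaches the weighted target, then some mixed strategy reaches
the target in every coordinate. -/
theorem exists_mixed_strategy {σ κ : Type} [Fintype σ] [Fintype κ] (A : σ → κ → ℝ) (t : κ → ℝ)
    (h : ∀ a : κ → ℝ, (∀ k, 0 ≤ a k) → ∃ s, ∑ k, a k * t k ≤ ∑ k, a k * A s k) :
    ∃ w ∈ stdSimplex ℝ σ, ∀ k, t k ≤ ∑ s, w s * A s k := by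
  by_contra! hno
  set φ : (σ → ℝ) →ₗ[ℝ] (κ → ℝ) := Fintype.linearCombination ℝ A with hφ
  have hφapp : ∀ w k, φ w k = ∑ s, w s * A s k := fun w k => by
    simp [hφ, Fintype.linearCombination_apply, Finset.sum_apply]
  have hdisj : Disjoint (φ '' stdSimplex ℝ σ) (Set.Ici t) := by
    rw [Set.disjoint_left]
    rintro _ ⟨w, hw, rfl⟩ hle
    obtain ⟨k, hk⟩ := hno w hw
    have := hle k
    rw [hφapp] at this
    exact absurd this (not_le.2 hk)
  obtain ⟨f, u, v, hfu, huv, hfv⟩ := geometric_hahn_banach_compact_closed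
    ((convex_stdSimplex ℝ σ).linear_image φ)
    ((isCompact_stdSimplex ℝ σ).image φ.continuous_of_finiteDimensional)
    (convex_Ici t) isClosed_Ici hdisj
  have hf : ∀ x : κ → ℝ, f x = ∑ k, f (Pi.single k 1) * x k := by
    intro x
    conv_lhs => rw [← Finset.univ_sum_single x, map_sum]
    refine Finset.sum_congr rfl fun k _ => ?_
    have : (Pi.single k (x k) : κ → ℝ) = x k • Pi.single k 1 := by
      rw [← Pi.single_smul, smul_eq_mul, mul_one]
    rw [this, map_smul, smul_eq_mul, mul_comm]
  have hpos : ∀ k, 0 ≤ f (Pi.single k 1) := by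
    intro k
    by_contra! hneg
    -- far out in direction `k` the functional would drop below `v`
    set r := (f t - v) / -f (Pi.single k 1) with hr
    have hr0 : 0 ≤ r := div_nonneg (by linarith [hfv t Set.self_mem_Ici]) (by linarith)
    have hmem : t + r • (Pi.single k 1 : κ → ℝ) ∈ Set.Ici t := by
      refine Set.mem_Ici.2 (le_add_of_nonneg_right (smul_nonneg hr0 ?_))
      exact Pi.single_nonneg.2 zero_le_one
    have := hfv _ hmem
    rw [map_add, map_smul, smul_eq_mul] at this
    have hrm : r * -f (Pi.single k 1) = f t - v := div_mul_cancel₀ _ (by linarith)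
    linarith
  obtain ⟨s, hs⟩ := h _ hpos
  rw [← hf, ← hf] at hs
  have h1 := hfu (A s) ⟨Pi.single s 1, single_mem_stdSimplex ℝ s, by
    funext k
    rw [hφapp, Finset.sum_eq_single s]
    · simp
    · intro s' _ hs'
      simp [hs']
    · simp⟩
  linarith [hfv t Set.self_mem_Ici]

theorem toReal_toOuterMeasure_bind {α β : Type} [Fintype α] (p : PMF α) (f : α → PMF β)
    (s : Set β) : ((p.bind f).toOuterMeasure s).toReal =
      ∑ a, (p a).toReal * ((f a).toOuterMeasure s).toReal := by
  rw [PMF.toOuterMeasure_bind_apply, tsum_fintype, ENNReal.toReal_sum]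
  · simp
  · intro a _
    refine ENNReal.mul_ne_top (p.apply_ne_top a) (ne_top_of_le_ne_top ENNReal.one_ne_top ?_)
    rw [PMF.toOuterMeasure_apply]
    exact (ENNReal.tsum_le_tsum fun b => Set.indicator_le_self _ _ _).trans (f a).tsum_coe.le

theorem toReal_toOuterMeasure {α : Type} [Fintype α] (p : PMF α) (s : Set α) :
    (p.toOuterMeasure s).toReal = ∑ a, (p a).toReal * if a ∈ s then 1 else 0 := by
  rw [PMF.toOuterMeasure_apply_fintype, ENNReal.toReal_sum]
  · refine Finset.sum_congr rfl fun a _ => ?_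
    by_cases h : a ∈ s <;> simp [h]
  · intro a _
    exact ne_top_of_le_ne_top (p.apply_ne_top a) (Set.indicator_le_self _ _ _)

theorem toReal_toOuterMeasure_const {α : Type} [Fintype α] (p : PMF α) (P : Prop)
    [Decidable P] :
    (p.toOuterMeasure {_a | P}).toReal = if P then 1 else 0 := by
  by_cases hP : P
  · have : p.toOuterMeasure {_a | P} = 1 :=
      (PMF.toOuterMeasure_apply_eq_one_iff _ _).2 fun _ _ => hP
    rw [this, if_pos hP, ENNReal.toReal_one]
  · simp [hP]

theorem exists_pmf_of_weights {α : Type} [Fintype α] (w : α → ℝ) (h0 : ∀ a, 0 ≤ w a)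
    (h1 : ∑ a, w a = 1) : ∃ p : PMF α, ∀ a, (p a).toReal = w a := by
  refine ⟨PMF.ofFintype (fun a => ENNReal.ofReal (w a)) ?_, fun a => ?_⟩
  · rw [← ENNReal.ofReal_sum_of_nonneg fun a _ => h0 a, h1, ENNReal.ofReal_one]
  · rw [PMF.ofFintype_apply, ENNReal.toReal_ofReal (h0 a)]

end Duality

/-! ### Schemes attaining the bounds -/

section Schemes

open scoped Classical

variable {B₁ B₂ I : Type} [Fintype B₁] [Fintype B₂] [Fintype I]

theorem OnlineRoundingScheme.prob_eq (S : OnlineRoundingScheme) (x : FractionalBatch B₁ I)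
    (y : FractionalBatch B₂ I) (P : Finset (B₁ × I) → Finset (B₂ × I) → Prop) :
    S.prob x y P = ∑ M₁, (S.first x M₁).toReal *
      ((S.second x y M₁).toOuterMeasure {M₂ | P M₁.1 M₂.1}).toReal := by
  rw [OnlineRoundingScheme.prob, OnlineRoundingScheme.outcome, toReal_toOuterMeasure_bind]
  refine Finset.sum_congr rfl fun M₁ _ => ?_
  rw [PMF.toOuterMeasure_map_apply]
  rfl

/-- A second stage that reaches prescribed probabilities `t k` of the events `Q k`, given for all
weights on the events a selection rule that reaches the weighted target. -/
theorem exists_second_stage {x : FractionalBatch B₁ I} {y : FractionalBatch B₂ I} {κ : Type}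
    [Fintype κ] (μ : FirstMatching x → ℝ)
    (Q : κ → Finset (B₁ × I) → Finset (B₂ × I) → Prop) (t : κ → ℝ)
    (h : ∀ a : κ → ℝ, (∀ k, 0 ≤ a k) → ∃ s : ∀ M₁ : FirstMatching x, SecondMatching M₁ y,
      ∑ k, a k * t k ≤ ∑ M₁, μ M₁ * ∑ k, a k * if Q k M₁.1 (s M₁).1 then 1 else 0) :
    ∃ τ : ∀ M₁ : FirstMatching x, PMF (SecondMatching M₁ y), ∀ k, t k ≤
      ∑ M₁, μ M₁ * ((τ M₁).toOuterMeasure {M₂ | Q k M₁.1 M₂.1}).toReal := by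
  obtain ⟨w, hw, hwt⟩ := exists_mixed_strategy
    (fun (s : ∀ M₁ : FirstMatching x, SecondMatching M₁ y) k =>
      ∑ M₁, μ M₁ * if Q k M₁.1 (s M₁).1 then 1 else 0) t fun a ha => by
    obtain ⟨s, hs⟩ := h a ha
    refine ⟨s, hs.trans_eq ?_⟩
    simp only [Finset.mul_sum]
    rw [Finset.sum_comm]
    exact Finset.sum_congr rfl fun k _ => Finset.sum_congr rfl fun M₁ _ => by ring
  obtain ⟨p, hp⟩ := exists_pmf_of_weights w hw.1 hw.2
  refine ⟨fun M₁ => p.map fun s => s M₁, fun k => (hwt k).trans_eq ?_⟩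
  simp only [PMF.toOuterMeasure_map_apply, toReal_toOuterMeasure, hp, Finset.mul_sum]
  rw [Finset.sum_comm]
  refine Finset.sum_congr rfl fun M₁ _ => Finset.sum_congr rfl fun s _ => ?_
  simp only [Set.mem_preimage, Set.mem_ofPred_eq]
  ring

theorem FractionalBatch.isFractionalMatching_mul (x : FractionalBatch B₁ I) {θ : ℝ} (h0 : 0 ≤ θ)
    (h1 : θ ≤ 1) : IsFractionalMatching fun e => θ * x.mass e := by
  refine ⟨fun e => mul_nonneg h0 (x.mass_nonneg e), fun b => ?_, fun i => ?_⟩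
  · rw [← Finset.mul_sum]
    exact mul_le_one₀ h1 (Finset.sum_nonneg fun i _ => x.mass_nonneg _) (x.online_le_one b)
  · rw [← Finset.mul_sum]
    exact mul_le_one₀ h1 (Finset.sum_nonneg fun i _ => x.mass_nonneg _) (x.offline_le_one i)

/-- Sums over the first-stage matchings are sums over all edge sets if the other summands vanish. -/
theorem sum_firstMatching {x : FractionalBatch B₁ I} {w : Finset (B₁ × I) → ℝ} {θ : ℝ}
    (hw : IsDependentRounding (fun e => θ * x.mass e) w) (g : Finset (B₁ × I) → ℝ) :
    ∑ M : FirstMatching x, w M.1 * g M.1 = ∑ M, w M * g M := by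
  rw [← Finset.sum_subtype (Finset.univ.filter fun M => M ⊆ x.edges ∧ IsMatching M) (by simp)
    fun M => w M * g M]
  refine Finset.sum_filter_of_ne fun M _ hM => ?_
  have hM' : w M ≠ 0 := left_ne_zero_of_mul hM
  refine ⟨fun e he => ?_, hw.isMatching M hM'⟩
  by_contra hne
  exact hw.support M hM' e he (by simp [x.mass_eq_zero e hne])

/-- A first stage that rounds `θ` times the given fractional matching dependently. -/
theorem exists_first_stage {θ : ℝ} (h0 : 0 ≤ θ) (h1 : θ ≤ 1) (x : FractionalBatch B₁ I) :
    ∃ p : PMF (FirstMatching x), ∃ w, IsDependentRounding (fun e => θ * x.mass e) w ∧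
      ∀ M, (p M).toReal = w M.1 := by
  obtain ⟨w, hw⟩ := exists_isDependentRounding _ (x.isFractionalMatching_mul h0 h1)
  obtain ⟨p, hp⟩ := exists_pmf_of_weights (fun M : FirstMatching x => w M.1)
    (fun M => hw.nonneg M.1) (by
      have := sum_firstMatching hw fun _ => 1
      simpa [hw.sum_eq_one] using this)
  exact ⟨p, w, hw, hp⟩

/-- The selection rule that picks an `ℓ`-optimal second matching. After a dependent first stage its
expected weight is at least that after an independent one. -/
theorem exists_optimal_rule {x : FractionalBatch B₁ I} (y : FractionalBatch B₂ I)
    {w : Finset (B₁ × I) → ℝ} {θ : ℝ} (hw : IsDependentRounding (fun e => θ * x.mass e) w)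
    (ℓ : B₂ × I → ℝ) :
    ∃ s : ∀ M₁ : FirstMatching x, SecondMatching M₁ y,
      multilinear (matchValue y.edges ℓ) (fun i => 1 - θ * x.degree i) ≤
        ∑ M₁ : FirstMatching x, w M₁.1 * ∑ e ∈ (s M₁).1, ℓ e := by
  have hopt : ∀ M₁ : FirstMatching x, ∃ M₂ : SecondMatching M₁ y,
      matchValue y.edges ℓ (Finset.univ.filter fun i => ¬Covers M₁.1 i) = ∑ e ∈ M₂.1, ℓ e := by
    intro M₁
    obtain ⟨M, hMD, hM, hMF, h⟩ := exists_matchValue_eq y.edges ℓ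
      (Finset.univ.filter fun i => ¬Covers M₁.1 i)
    refine ⟨⟨M, hMD, hM, ?_⟩, h⟩
    rintro i ⟨b, hb⟩
    exact (Finset.mem_filter.1 (hMF _ hb)).2
  choose s hs using hopt
  refine ⟨s, ?_⟩
  have h1 := hw.multilinear_matchValue_le y.edges ℓ
  rw [← sum_firstMatching hw] at h1
  simp only [hs, ← Finset.mul_sum] at h1
  exact h1

/-- The target of a node is met in weighted form: the first stage covers the node `i` with
probability `x.degree i`, and an optimal second matching adds what the multilinear bound gives. -/
theorem exists_vertex_second_stage {x : FractionalBatch B₁ I} {y : FractionalBatch B₂ I}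
    (hxy : JointlyFeasible x y) {p : PMF (FirstMatching x)} {w : Finset (B₁ × I) → ℝ}
    (hw : IsDependentRounding (fun e => 1 * x.mass e) w) (hp : ∀ M, (p M).toReal = w M.1) :
    ∃ τ : ∀ M₁ : FirstMatching x, PMF (SecondMatching M₁ y), ∀ i,
      7 / 8 * (x.degree i + y.degree i) ≤ ∑ M₁, (p M₁).toReal *
        ((τ M₁).toOuterMeasure {M₂ | Covers M₁.1 i ∨ Covers M₂.1 i}).toReal := by
  refine exists_second_stage _ (fun i M₁ M₂ => Covers M₁ i ∨ Covers M₂ i)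
    (fun i => 7 / 8 * (x.degree i + y.degree i)) fun a ha => ?_
  obtain ⟨s, hs⟩ := exists_optimal_rule y hw fun e => a e.2
  refine ⟨s, ?_⟩
  have hy : IsFractionalMatching y.mass := ⟨y.mass_nonneg, y.online_le_one, y.offline_le_one⟩
  have hbound := vertex_le_multilinear_matchValue hy (fun e he => y.mass_eq_zero e he)
    (x := x.degree) (a := a) (fun i => Finset.sum_nonneg fun b _ => x.mass_nonneg _) hxy ha
  simp only [one_mul] at hs
  have hcov : ∀ M₁ : FirstMatching x,
      ∑ i, a i * (if Covers M₁.1 i ∨ Covers (s M₁).1 i then 1 else 0) =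
      ∑ i, a i * coverVec M₁.1 i + ∑ e ∈ (s M₁).1, a e.2 := by
    intro M₁
    rw [← sum_mul_coverVec (s M₁).2.2.1, ← Finset.sum_add_distrib]
    refine Finset.sum_congr rfl fun i _ => ?_
    have := (s M₁).2.2.2 i
    by_cases h1 : Covers M₁.1 i <;> by_cases h3 : Covers (s M₁).1 i
    · exact absurd h1 (this h3)
    all_goals simp [coverVec, h1, h3]
  have hfirst : ∑ M₁ : FirstMatching x, w M₁.1 * ∑ i, a i * coverVec M₁.1 i =
      ∑ i, a i * x.degree i := by
    rw [sum_firstMatching hw fun M => ∑ i, a i * coverVec M i]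
    simp only [Finset.mul_sum]
    rw [Finset.sum_comm]
    refine Finset.sum_congr rfl fun i _ => ?_
    have := hw.sum_coverVec i
    simp only [one_mul] at this
    rw [FractionalBatch.degree, ← this, Finset.mul_sum]
    exact Finset.sum_congr rfl fun M _ => by ring
  have hsplit : ∑ i, a i * (7 / 8 * (x.degree i + y.degree i)) =
      ∑ i, a i * x.degree i +
        ∑ i, a i * (∑ b, y.mass (b, i) - (x.degree i + ∑ b, y.mass (b, i)) / 8) := by
    rw [← Finset.sum_add_distrib]
    refine Finset.sum_congr rfl fun i _ => ?_
    rw [FractionalBatch.degree, FractionalBatch.degree]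
    ring
  rw [hsplit, ← hfirst]
  refine (add_le_add_right (hbound.trans hs) _).trans (le_of_eq ?_)
  rw [← Finset.sum_add_distrib]
  refine Finset.sum_congr rfl fun M₁ _ => ?_
  rw [hp, ← mul_add, ← hcov]
  congr!

/-- Scaling the first batch by `c` frees each offline node with probability at least `1 - c` plus
`c` times its value in the second batch, as the multilinear bound requires. -/
theorem exists_edge_second_stage {x : FractionalBatch B₁ I} {y : FractionalBatch B₂ I}
    (hxy : JointlyFeasible x y) {p : PMF (FirstMatching x)} {w : Finset (B₁ × I) → ℝ}
    (hw : IsDependentRounding (fun e => edgeFactor * x.mass e) w)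
    (hp : ∀ M, (p M).toReal = w M.1) :
    ∃ τ : ∀ M₁ : FirstMatching x, PMF (SecondMatching M₁ y), ∀ e,
      edgeFactor * y.mass e ≤ ∑ M₁, (p M₁).toReal *
        ((τ M₁).toOuterMeasure {M₂ | e ∈ M₂.1}).toReal := by
  obtain ⟨hc1, hc2⟩ := edgeFactor_bounds
  refine exists_second_stage _ (fun e _ M₂ => e ∈ M₂) (fun e => edgeFactor * y.mass e)
    fun a _ => ?_
  obtain ⟨s, hs⟩ := exists_optimal_rule y hw a
  refine ⟨s, ?_⟩
  have hbound := edge_le_multilinear_matchValue a y.edges y.mass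
    (fun i => 1 - edgeFactor * x.degree i) y.mass_nonneg (fun e he => y.mass_eq_zero e he)
    y.online_le_one (fun i => by
      have := hxy i
      rw [FractionalBatch.degree, FractionalBatch.degree] at this
      rw [FractionalBatch.degree]
      nlinarith)
    (fun i => by
      have : 0 ≤ x.degree i := Finset.sum_nonneg fun b _ => x.mass_nonneg _
      nlinarith)
  have hsum : ∀ M₁ : FirstMatching x,
      ∑ e, a e * (if e ∈ (s M₁).1 then 1 else 0) = ∑ e ∈ (s M₁).1, a e := fun M₁ => by simp
  have hlhs : ∑ e, a e * (edgeFactor * y.mass e) = edgeFactor * ∑ e, a e * y.mass e := by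
    rw [Finset.mul_sum]
    exact Finset.sum_congr rfl fun e _ => by ring
  rw [hlhs]
  refine (hbound.trans hs).trans (le_of_eq (Finset.sum_congr rfl fun M₁ _ => ?_))
  rw [hp, ← hsum]
  congr!

theorem exists_isVertexUniform : ∃ S : OnlineRoundingScheme, S.IsVertexUniform (7 / 8) := by
  have hsecond : ∀ {I B₁ B₂ : Type} [Fintype I] [Fintype B₁] [Fintype B₂]
      (x : FractionalBatch B₁ I) (y : FractionalBatch B₂ I),
      ∃ τ : ∀ M₁ : FirstMatching x, PMF (SecondMatching M₁ y), JointlyFeasible x y → ∀ i,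
        7 / 8 * (x.degree i + y.degree i) ≤
          ∑ M₁, ((exists_first_stage zero_le_one le_rfl x).choose M₁).toReal *
            ((τ M₁).toOuterMeasure {M₂ | Covers M₁.1 i ∨ Covers M₂.1 i}).toReal := by
    intro I B₁ B₂ _ _ _ x y
    by_cases hxy : JointlyFeasible x y
    · obtain ⟨w, hw, hp⟩ := (exists_first_stage zero_le_one le_rfl x).choose_spec
      obtain ⟨τ, hτ⟩ := exists_vertex_second_stage hxy hw hp
      exact ⟨τ, fun _ => hτ⟩
    · exact ⟨fun M₁ => PMF.pure ⟨∅, by simp [isMatching_empty, Covers]⟩, fun h => absurd h hxy⟩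
  refine ⟨⟨fun x => (exists_first_stage zero_le_one le_rfl x).choose,
    fun x y => (hsecond x y).choose⟩, ?_⟩
  intro I B₁ B₂ _ _ _ x y hxy i
  rw [OnlineRoundingScheme.prob_eq]
  exact (hsecond x y).choose_spec hxy i

theorem exists_isEdgeUniform : ∃ S : OnlineRoundingScheme, S.IsEdgeUniform edgeFactor := by
  have h0 : 0 ≤ edgeFactor := by linarith [edgeFactor_bounds.1]
  have h1 : edgeFactor ≤ 1 := by linarith [edgeFactor_bounds.2]
  have hsecond : ∀ {I B₁ B₂ : Type} [Fintype I] [Fintype B₁] [Fintype B₂]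
      (x : FractionalBatch B₁ I) (y : FractionalBatch B₂ I),
      ∃ τ : ∀ M₁ : FirstMatching x, PMF (SecondMatching M₁ y), JointlyFeasible x y → ∀ e,
        edgeFactor * y.mass e ≤ ∑ M₁, ((exists_first_stage h0 h1 x).choose M₁).toReal *
          ((τ M₁).toOuterMeasure {M₂ | e ∈ M₂.1}).toReal := by
    intro I B₁ B₂ _ _ _ x y
    by_cases hxy : JointlyFeasible x y
    · obtain ⟨w, hw, hp⟩ := (exists_first_stage h0 h1 x).choose_spec
      obtain ⟨τ, hτ⟩ := exists_edge_second_stage hxy hw hp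
      exact ⟨τ, fun _ => hτ⟩
    · exact ⟨fun M₁ => PMF.pure ⟨∅, by simp [isMatching_empty, Covers]⟩, fun h => absurd h hxy⟩
  refine ⟨⟨fun x => (exists_first_stage h0 h1 x).choose, fun x y => (hsecond x y).choose⟩, ?_⟩
  intro I B₁ B₂ _ _ _ x y hxy
  refine ⟨fun e _ => ?_, fun e _ => ?_⟩
  · obtain ⟨w, hw, hp⟩ := (exists_first_stage h0 h1 x).choose_spec
    rw [OnlineRoundingScheme.prob_eq]
    simp only [hp, toReal_toOuterMeasure_const]
    rw [sum_firstMatching hw fun M => if e ∈ M then 1 else 0, hw.marginal]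
  · rw [OnlineRoundingScheme.prob_eq]
    exact (hsecond x y).choose_spec hxy e

end Schemes

/-! ### Upper bounds -/

section UpperBounds

open scoped Classical

/-- The first batch of the hard instances: every online node is spread evenly over all offline
nodes. There are twice as many of the latter, which thereby have degree `1 / 2`. -/
noncomputable def uniformBatch (B I : Type) [Fintype B] [Fintype I]
    (hcard : Fintype.card I = 2 * Fintype.card B) : FractionalBatch B I where
  edges := Finset.univ
  mass _ := (Fintype.card I : ℝ)⁻¹
  mass_nonneg _ := by positivity
  mass_eq_zero e he := absurd (Finset.mem_univ e) he
  online_le_one _ := by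
    rw [Finset.sum_const, Finset.card_univ, nsmul_eq_mul]
    exact mul_inv_le_one
  offline_le_one _ := by
    rw [Finset.sum_const, Finset.card_univ, nsmul_eq_mul]
    refine le_trans (mul_le_mul_of_nonneg_right ?_ (by positivity))
      (mul_inv_le_one (a := (Fintype.card I : ℝ)))
    exact_mod_cast (by omega : Fintype.card B ≤ Fintype.card I)

theorem uniformBatch_degree {B I : Type} [Fintype B] [Fintype I]
    {hcard : Fintype.card I = 2 * Fintype.card B} (i : I) :
    (uniformBatch B I hcard).degree i = 1 / 2 := by
  have hI : (Fintype.card I : ℝ) ≠ 0 := by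
    exact_mod_cast (Fintype.card_pos_iff.2 ⟨i⟩).ne'
  have hcard' : (Fintype.card I : ℝ) = 2 * Fintype.card B := by exact_mod_cast hcard
  simp only [FractionalBatch.degree, uniformBatch, Finset.sum_const, Finset.card_univ,
    nsmul_eq_mul]
  rw [← div_eq_mul_inv, div_eq_iff hI, hcard']
  ring

/-- The second batch of the hard instances: one online node with value `1 / 2` at each of the
offline nodes `u` and `w`. -/
noncomputable def pairBatch {I : Type} [Fintype I] (u w : I) : FractionalBatch Unit I where
  edges := Finset.univ
  mass e := ((if e.2 = u then 1 else 0) + if e.2 = w then 1 else 0) / 2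
  mass_nonneg e := by split_ifs <;> norm_num
  mass_eq_zero e he := absurd (Finset.mem_univ e) he
  online_le_one _ := by
    rw [← Finset.sum_div, Finset.sum_add_distrib]
    simp
  offline_le_one i := by
    rw [Finset.univ_unique, Finset.sum_singleton]
    split_ifs <;> norm_num

theorem pairBatch_degree {I : Type} [Fintype I] (u w i : I) :
    (pairBatch u w).degree i = ((if i = u then 1 else 0) + if i = w then 1 else 0) / 2 := by
  simp [FractionalBatch.degree, pairBatch]

theorem pairBatch_mass {I : Type} [Fintype I] (u w : I) (e : Unit × I) :
    (pairBatch u w).mass e = ((if e.2 = u then 1 else 0) + if e.2 = w then 1 else 0) / 2 :=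
  rfl

theorem jointlyFeasible_uniform_pair {B I : Type} [Fintype B] [Fintype I]
    {hcard : Fintype.card I = 2 * Fintype.card B} {u w : I} (huw : u ≠ w) :
    JointlyFeasible (uniformBatch B I hcard) (pairBatch u w) := by
  intro i
  rw [uniformBatch_degree, pairBatch_degree]
  by_cases h1 : i = u <;> by_cases h2 : i = w
  · exact absurd (h1.symm.trans h2) huw
  all_goals simp only [h1, h2, huw, huw.symm, if_true, if_false]; norm_num

theorem sum_coverVec_eq_card {B I : Type} [Fintype B] [Fintype I] {M : Finset (B × I)}
    (hM : IsMatching M) : ∑ i, coverVec M i = M.card := by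
  simpa using sum_mul_coverVec hM fun _ => 1

theorem IsMatching.card_le {B I : Type} [Fintype B] {M : Finset (B × I)} (hM : IsMatching M) :
    M.card ≤ Fintype.card B := by
  rw [← Finset.card_univ]
  refine Finset.card_le_card_of_injOn Prod.fst (fun _ _ => Finset.mem_coe.2 (Finset.mem_univ _)) ?_
  exact fun e he f hf h => hM e he f hf (Or.inl h)

/-- Averaging over all pairs: if `k a` is a random 0-1 vector and every two coordinates are both one
with probability at most `C`, then their sum has a small second factorial moment. -/
theorem sum_sq_sub_le_of_pairs {α I : Type} [Fintype α] [Fintype I] (p : α → ℝ) (k : α → I → ℝ)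
    (hk : ∀ a i, k a i = 0 ∨ k a i = 1) {C : ℝ}
    (hC : ∀ u w, u ≠ w → ∑ a, p a * (k a u * k a w) ≤ C) :
    ∑ a, p a * ((∑ i, k a i) ^ 2 - ∑ i, k a i) ≤
      Fintype.card I * (Fintype.card I - 1) * C := by
  have hterm : ∀ a, (∑ i, k a i) ^ 2 - ∑ i, k a i =
      ∑ u, ∑ w ∈ Finset.univ.erase u, k a u * k a w := by
    intro a
    rw [sq, Finset.sum_mul, ← Finset.sum_sub_distrib]
    refine Finset.sum_congr rfl fun u _ => ?_
    rw [← Finset.mul_sum, ← Finset.add_sum_erase _ _ (Finset.mem_univ u)]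
    rcases hk a u with h | h <;> rw [h] <;> ring
  simp only [hterm, Finset.mul_sum]
  rw [Finset.sum_comm]
  have hle : ∀ u ∈ (Finset.univ : Finset I),
      ∑ a, ∑ w ∈ Finset.univ.erase u, p a * (k a u * k a w) ≤ (Fintype.card I - 1) * C := by
    intro u _
    rw [Finset.sum_comm]
    refine (Finset.sum_le_card_nsmul _ _ C fun w hw =>
      hC u w (Finset.ne_of_mem_erase hw).symm).trans_eq ?_
    rw [Finset.card_erase_of_mem (Finset.mem_univ u), Finset.card_univ, nsmul_eq_mul,
      Nat.cast_sub (Fintype.card_pos_iff.2 ⟨u⟩), Nat.cast_one]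
  refine (Finset.sum_le_card_nsmul _ _ _ hle).trans_eq ?_
  rw [Finset.card_univ, nsmul_eq_mul, mul_assoc]

theorem sum_toReal_eq_one {α : Type} [Fintype α] (p : PMF α) : ∑ a, (p a).toReal = 1 := by
  rw [← ENNReal.toReal_sum fun a _ => p.apply_ne_top a, ← tsum_fintype (L := .unconditional α),
    p.tsum_coe, ENNReal.toReal_one]

/-- Two events of which no outcome realizes more than `C` have total probability at most `C`. -/
theorem toReal_add_toReal_le {α : Type} [Fintype α] (p : PMF α) (s t : Set α) {C : ℝ}
    (h : ∀ a, (if a ∈ s then (1 : ℝ) else 0) + (if a ∈ t then 1 else 0) ≤ C) :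
    (p.toOuterMeasure s).toReal + (p.toOuterMeasure t).toReal ≤ C := by
  rw [toReal_toOuterMeasure, toReal_toOuterMeasure, ← Finset.sum_add_distrib]
  have : C = ∑ a, (p a).toReal * C := by rw [← Finset.sum_mul, sum_toReal_eq_one, one_mul]
  rw [this]
  refine Finset.sum_le_sum fun a _ => ?_
  rw [← mul_add]
  exact mul_le_mul_of_nonneg_left (h a) ENNReal.toReal_nonneg

theorem nonpos_of_forall_nat_mul_le {a b : ℝ} (h : ∀ n : ℕ, 0 < n → n * a ≤ b) : a ≤ 0 := by
  by_contra! ha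
  obtain ⟨n, hn⟩ := exists_nat_gt (b / a)
  have h1 := h (n + 1) n.succ_pos
  have h2 := (div_lt_iff₀ ha).1 hn
  push_cast at h1
  linarith

/-- A single online node covers at most one of two free offline nodes. -/
theorem SecondMatching.not_mem_pair {B₁ I : Type} [Fintype B₁] [Fintype I]
    {x : FractionalBatch B₁ I} {y : FractionalBatch Unit I} {M₁ : FirstMatching x}
    (M₂ : SecondMatching M₁ y) {u w : I} (huw : u ≠ w) (hu : Covers M₂.1 u) :
    ¬Covers M₂.1 w := by
  rintro ⟨b, hb⟩
  obtain ⟨b', hb'⟩ := hu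
  exact huw (Prod.ext_iff.1 (M₂.2.2.1 _ hb' _ hb (Or.inl rfl))).2

/-- The bound on a vertex-uniform factor that `n` online nodes in the first batch give. -/
theorem OnlineRoundingScheme.IsVertexUniform.mul_le {S : OnlineRoundingScheme} {c : ℝ}
    (hS : S.IsVertexUniform c) {B I : Type} [Fintype B] [Fintype I]
    (hcard : Fintype.card I = 2 * Fintype.card B) (hn : 0 < Fintype.card B) :
    Fintype.card B * (8 * c - 7) ≤ 4 * c - 3 := by
  set n := Fintype.card B
  set x := uniformBatch B I hcard
  -- both nodes of the pair are free with probability at most `2 - 2 * c`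
  have hpair : ∀ u w : I, u ≠ w → ∑ M₁, (S.first x M₁).toReal *
      ((1 - coverVec M₁.1 u) * (1 - coverVec M₁.1 w)) ≤ 2 - 2 * c := by
    intro u w huw
    have hfeas := jointlyFeasible_uniform_pair (hcard := hcard) huw
    have hu := hS x (pairBatch u w) hfeas u
    have hw := hS x (pairBatch u w) hfeas w
    rw [uniformBatch_degree, pairBatch_degree, OnlineRoundingScheme.prob_eq] at hu hw
    simp only [if_true, huw, huw.symm, if_false] at hu hw
    have hsum : 2 * c ≤ ∑ M₁, (S.first x M₁).toReal *
        (2 - (1 - coverVec M₁.1 u) * (1 - coverVec M₁.1 w)) := by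
      have hadd := add_le_add hu hw
      rw [← Finset.sum_add_distrib] at hadd
      refine (le_of_eq (by ring)).trans (hadd.trans (Finset.sum_le_sum fun M₁ _ => ?_))
      rw [← mul_add]
      refine mul_le_mul_of_nonneg_left (toReal_add_toReal_le _ _ _ fun M₂ => ?_)
        ENNReal.toReal_nonneg
      have hno := SecondMatching.not_mem_pair M₂ huw
      simp only [Set.mem_ofPred_eq, coverVec]
      by_cases h1 : Covers M₁.1 u <;> by_cases h2 : Covers M₁.1 w <;>
        by_cases h3 : Covers M₂.1 u <;> by_cases h4 : Covers M₂.1 w <;>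
          simp only [h1, h2, h3, h4, true_or, or_true, or_self, if_true, if_false] <;>
            first | exact absurd h4 (hno h3) | norm_num
    simp only [mul_sub (S.first x _).toReal, Finset.sum_sub_distrib, ← Finset.sum_mul,
      sum_toReal_eq_one] at hsum
    linarith
  have hmom := sum_sq_sub_le_of_pairs (fun M₁ => (S.first x M₁).toReal)
    (fun (M₁ : FirstMatching x) i => 1 - coverVec M₁.1 i)
    (fun M₁ i => by rcases coverVec_eq_zero_or_one M₁.1 i with h | h <;> simp [h]) hpair
  have hn1 : (1 : ℝ) ≤ n := by exact_mod_cast hn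
  -- at least `n` of the `2 * n` offline nodes stay free
  have hlow : (n : ℝ) ^ 2 - n ≤ ∑ M₁, (S.first x M₁).toReal *
      ((∑ i, (1 - coverVec M₁.1 i)) ^ 2 - ∑ i, (1 - coverVec M₁.1 i)) := by
    have h1 : (n : ℝ) ^ 2 - n = ∑ M₁, (S.first x M₁).toReal * ((n : ℝ) ^ 2 - n) := by
      rw [← Finset.sum_mul, sum_toReal_eq_one, one_mul]
    rw [h1]
    refine Finset.sum_le_sum fun M₁ _ => mul_le_mul_of_nonneg_left ?_ ENNReal.toReal_nonneg
    rw [Finset.sum_sub_distrib, sum_coverVec_eq_card M₁.2.2]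
    have hM : ((M₁.1.card : ℕ) : ℝ) ≤ n := by
      exact_mod_cast M₁.2.2.card_le
    simp only [Finset.sum_const, Finset.card_univ, hcard, nsmul_eq_mul, mul_one]
    push_cast
    nlinarith
  have hfin := hlow.trans hmom
  rw [hcard] at hfin
  push_cast at hfin
  have hn0 : (0 : ℝ) < n := by linarith
  have : (n : ℝ) * (n * (8 * c - 7) - (4 * c - 3)) ≤ 0 := by nlinarith
  by_contra! hlt
  exact absurd this (not_le.2 (mul_pos hn0 (by linarith)))

/-- The bound on an edge-uniform factor that `n` online nodes in the first batch give. -/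
theorem OnlineRoundingScheme.IsEdgeUniform.mul_le {S : OnlineRoundingScheme} {c : ℝ}
    (hS : S.IsEdgeUniform c) (hc0 : 0 < c) {B I : Type} [Fintype B] [Fintype I]
    (hcard : Fintype.card I = 2 * Fintype.card B) (hn : 0 < Fintype.card B) :
    Fintype.card B * (c ^ 2 + 4 * c - 4) ≤ 2 * c - 1 := by
  set n := Fintype.card B
  set x := uniformBatch B I hcard
  have hn1 : (1 : ℝ) ≤ n := by exact_mod_cast hn
  have hn0 : (0 : ℝ) < n := by linarith
  -- both nodes of the pair are occupied with probability at most `1 - c`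
  have hpair : ∀ u w : I, u ≠ w → ∑ M₁, (S.first x M₁).toReal *
      (coverVec M₁.1 u * coverVec M₁.1 w) ≤ 1 - c := by
    intro u w huw
    have hfeas := jointlyFeasible_uniform_pair (hcard := hcard) huw
    have hu := (hS x (pairBatch u w) hfeas).2 ((), u) (Finset.mem_univ _)
    have hw := (hS x (pairBatch u w) hfeas).2 ((), w) (Finset.mem_univ _)
    rw [OnlineRoundingScheme.prob_eq, pairBatch_mass] at hu hw
    simp only [if_true, huw, huw.symm, if_false] at hu hw
    have hsum : c ≤ ∑ M₁, (S.first x M₁).toReal *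
        (1 - coverVec M₁.1 u * coverVec M₁.1 w) := by
      have hadd := add_le_add hu hw
      rw [← Finset.sum_add_distrib] at hadd
      refine (le_of_eq (by ring)).trans (hadd.trans (Finset.sum_le_sum fun M₁ _ => ?_))
      rw [← mul_add]
      refine mul_le_mul_of_nonneg_left (toReal_add_toReal_le _ _ _ fun M₂ => ?_)
        ENNReal.toReal_nonneg
      have hno := SecondMatching.not_mem_pair M₂ huw
      have hfree := M₂.2.2.2
      have hcov : ∀ i, ((), i) ∈ M₂.1 → Covers M₂.1 i := fun i h => ⟨(), h⟩
      simp only [Set.mem_ofPred_eq, coverVec]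
      by_cases h3 : ((), u) ∈ M₂.1 <;> by_cases h4 : ((), w) ∈ M₂.1
      · exact absurd (hcov w h4) (hno (hcov u h3))
      · rw [if_pos h3, if_neg h4, if_neg (hfree u (hcov u h3))]
        norm_num
      · rw [if_neg h3, if_pos h4, if_neg (hfree w (hcov w h4))]
        norm_num
      · rw [if_neg h3, if_neg h4]
        split_ifs <;> norm_num
    simp only [mul_sub (S.first x _).toReal, Finset.sum_sub_distrib, mul_one,
      sum_toReal_eq_one] at hsum
    linarith
  have hmom := sum_sq_sub_le_of_pairs (fun M₁ => (S.first x M₁).toReal)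
    (fun (M₁ : FirstMatching x) i => coverVec M₁.1 i)
    (fun M₁ i => coverVec_eq_zero_or_one M₁.1 i) hpair
  -- the first matching has expected size at least `c * n`
  have hsize : c * n ≤ ∑ M₁, (S.first x M₁).toReal * ∑ i, coverVec M₁.1 i := by
    obtain ⟨u, w, huw⟩ := Fintype.exists_pair_of_one_lt_card (α := I) (by omega)
    have htot : ∑ _e : B × I, c * (Fintype.card I : ℝ)⁻¹ ≤
        ∑ e : B × I, ∑ M₁, (S.first x M₁).toReal * if e ∈ M₁.1 then 1 else 0 := by
      refine Finset.sum_le_sum fun e _ => ?_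
      have he := (hS x (pairBatch u w) (jointlyFeasible_uniform_pair huw)).1 e
        (Finset.mem_univ e)
      rw [OnlineRoundingScheme.prob_eq] at he
      simp only [toReal_toOuterMeasure_const] at he
      exact he
    rw [Finset.sum_comm, Finset.sum_const, Finset.card_univ, Fintype.card_prod,
      nsmul_eq_mul, hcard] at htot
    have hl : ((n * (2 * n) : ℕ) : ℝ) * (c * ((2 * n : ℕ) : ℝ)⁻¹) = c * n := by
      push_cast
      field_simp
    rw [hl] at htot
    refine htot.trans_eq (Finset.sum_congr rfl fun M₁ _ => ?_)
    rw [← Finset.mul_sum, sum_coverVec_eq_card M₁.2.2]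
    simp
  have hlow : (c * n) ^ 2 - n ≤ ∑ M₁, (S.first x M₁).toReal *
      ((∑ i, coverVec M₁.1 i) ^ 2 - ∑ i, coverVec M₁.1 i) := by
    have hpt : ∑ M₁, (S.first x M₁).toReal *
        (2 * (c * n) * (∑ i, coverVec M₁.1 i) - (c * n) ^ 2 - n) ≤
        ∑ M₁, (S.first x M₁).toReal *
          ((∑ i, coverVec M₁.1 i) ^ 2 - ∑ i, coverVec M₁.1 i) := by
      refine Finset.sum_le_sum fun M₁ _ => mul_le_mul_of_nonneg_left ?_ ENNReal.toReal_nonneg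
      rw [sum_coverVec_eq_card M₁.2.2]
      have hM : ((M₁.1.card : ℕ) : ℝ) ≤ n := by
        exact_mod_cast M₁.2.2.card_le
      nlinarith [sq_nonneg ((M₁.1.card : ℝ) - c * n)]
    refine le_trans ?_ hpt
    simp only [mul_sub (S.first x _).toReal, Finset.sum_sub_distrib, ← Finset.sum_mul,
      sum_toReal_eq_one]
    have hcomm : ∑ M₁, (S.first x M₁).toReal * (2 * (c * n) * ∑ i, coverVec M₁.1 i) =
        2 * (c * n) * ∑ M₁, (S.first x M₁).toReal * ∑ i, coverVec M₁.1 i := by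
      rw [Finset.mul_sum]
      exact Finset.sum_congr rfl fun M₁ _ => by ring
    rw [hcomm]
    nlinarith [mul_le_mul_of_nonneg_left hsize (by positivity : 0 ≤ 2 * (c * n))]
  have hfin := hlow.trans hmom
  rw [hcard] at hfin
  push_cast at hfin
  have : (n : ℝ) * (n * (c ^ 2 + 4 * c - 4) - (2 * c - 1)) ≤ 0 := by nlinarith
  by_contra! hlt'
  exact absurd this (not_le.2 (mul_pos hn0 (by linarith)))

theorem le_of_isVertexUniform {S : OnlineRoundingScheme} {c : ℝ} (hS : S.IsVertexUniform c) :
    c ≤ 7 / 8 := by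
  have h : ∀ n : ℕ, 0 < n → n * (8 * c - 7) ≤ 4 * c - 3 := fun n hn => by
    simpa using hS.mul_le (B := Fin n) (I := Fin (2 * n)) (by simp) (by simpa using hn)
  linarith [nonpos_of_forall_nat_mul_le h]

theorem le_of_isEdgeUniform {S : OnlineRoundingScheme} {c : ℝ} (hS : S.IsEdgeUniform c) :
    c ≤ edgeFactor := by
  by_contra! hlt
  obtain ⟨hc1, hc2⟩ := edgeFactor_bounds
  have hc0 : 0 < c := by linarith
  have h : ∀ n : ℕ, 0 < n → n * (c ^ 2 + 4 * c - 4) ≤ 2 * c - 1 := fun n hn => by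
    simpa using hS.mul_le hc0 (B := Fin n) (I := Fin (2 * n)) (by simp) (by simpa using hn)
  nlinarith [nonpos_of_forall_nat_mul_le h, edgeFactor_sq]

end UpperBounds

end TwoStageMatching

theorem mainTheorem3 :
    IsGreatest {c : ℝ | ∃ S : TwoStageMatching.OnlineRoundingScheme, S.IsVertexUniform c}
      (7 / 8) ∧
    IsGreatest {c : ℝ | ∃ S : TwoStageMatching.OnlineRoundingScheme, S.IsEdgeUniform c}
      (2 * Real.sqrt 2 - 2) :=
  ⟨⟨TwoStageMatching.exists_isVertexUniform,
      fun _ ⟨_, hS⟩ => TwoStageMatching.le_of_isVertexUniform hS⟩,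
    ⟨TwoStageMatching.exists_isEdgeUniform,
      fun _ ⟨_, hS⟩ => TwoStageMatching.le_of_isEdgeUniform hS⟩⟩
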